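/- Consider incremental (insertion-only) sequences $\mathcal G=(G_1,\dots,G_T)$ of finite simple undirected graphs with edge weights in $\{1,\dots,W\}$, $W\ge 1$: starting from an initial graph $G_0=(V_0,E_0)$, which may be non-empty, the graph $G_t=(V_t,E_t)$ arises from $G_{t-1}$ by inserting a set of nodes and a set of edges with endpoints in $V_t$. Weights of edges do not change over time. Let $w_{\mathrm{MST}}(G)$ be the weight of a minimum spanning tree of $G$ (of a minimum spanning forest, if $G$ is disconnected), and let $\Delta w_{\mathrm{MST}}(t)=w_{\mathrm{MST}}(G_t)-w_{\mathrm{MST}}(G_{t-1})$ for $1\le t\le T$. Two incremental sequences of the same length are edge-adjacent if they have the same initial graph, the same insertions and the same weights of common edges, except that at exactly one time step one of them inserts exactly one additional edge. A randomized algorithm releases a real number at each time step $t=1,\dots,T$, where its outputs up to time $t$ depend only on $G_0,\dots,G_t$; the length $T$ is known in advance. It is $\varepsilon$-edge-differentially private if for all edge-adjacent $\mathcal G,\mathcal G'$ and all measurable $O\subseteq\mathbb R^T$, the vectors of all outputs satisfy $\Pr[\mathcal A(\mathcal G)\in O]\le e^{\varepsilon}\Pr[\mathcal A(\mathcal G')\in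 O]$. (1) There is an absolute constant $C>0$ such that for all $W\ge 1$, $T\ge 2$ and $\varepsilon>0$ there is an $\varepsilon$-edge-differentially private algorithm $\mathcal A$ on incremental sequences of length $T$ with edge weights in $\{1,\dots,W\}$ such that, for every such sequence, every time step $t\in\{1,\dots,T\}$ and every $\delta\in(0,1)$, with probability at least $1-\delta$ the output at time $t$ differs from $w_{\mathrm{MST}}(G_t)$ by at most $C\,W\,\varepsilon^{-1}\,\log^{3/2}T\,\log\delta^{-1}$. (2) Let $W\ge 1$, and let nodes be taken from an infinite set. For all $T$ and all edge-adjacent incremental sequences $\mathcal G,\mathcal G'$ of length $T$ with edge weights in $\{1,\dots,W\}$ in which all graphs $G_1,\dots,G_T,G_1',\dots,G_T'$ are connected, $$\sum_{t=1}^T\bigl|\Delta w_{\mathrm{MST},\mathcal G}(t)-\Delta w_{\mathrm{MST},\mathcal G'}(t)\bigr|\le 2W-2,$$ and for every $T\ge 2$ equality is attained by some such pair; that is, the continuous global sensitivity of the difference sequence of the minimum spanning tree weight under edge-adjacency is $2W-2$. -/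

import Mathlib

open MeasureTheory

universe u

/-- The data of an insertion-only sequence of edge-weighted graphs `G_0, G_1, …, G_T` with nodes
from `V`: the initial node and edge sets, the node and edge sets inserted at each of the `T` time
steps (the entry `i : Fin T` is the update at time `i + 1`), and the edge weights. Only the weights
of edges that occur in the sequence have a meaning. -/
structure InsertionData (V : Type u) (T : ℕ) where
  initVerts : Finset V
  initEdges : Finset (Sym2 V)
  insVerts : Fin T → Finset V
  insEdges : Fin T → Finset (Sym2 V)
  weight : Sym2 V → ℕ

namespace InsertionData

variable {V : Type u} [DecidableEq V] {T : ℕ}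

/-- The node set `V_t` of `G_t`. -/
def verts (S : InsertionData V T) (t : ℕ) : Finset V :=
  S.initVerts ∪ (Finset.univ.filter fun i : Fin T => i.val < t).biUnion S.insVerts

/-- The edge set `E_t` of `G_t`. -/
def edges (S : InsertionData V T) (t : ℕ) : Finset (Sym2 V) :=
  S.initEdges ∪ (Finset.univ.filter fun i : Fin T => i.val < t).biUnion S.insEdges

end InsertionData

/-- `F` is a spanning forest of the graph with edge set `E`: a cycle-free set of edges of that
graph with the same connected components. If the graph is connected, this is a spanning tree. -/
def IsSpanningForest {V : Type u} (E F : Finset (Sym2 V)) : Prop :=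
  F ⊆ E ∧ (SimpleGraph.fromEdgeSet (F : Set (Sym2 V))).IsAcyclic ∧
    ∀ u v : V, (SimpleGraph.fromEdgeSet (E : Set (Sym2 V))).Reachable u v →
      (SimpleGraph.fromEdgeSet (F : Set (Sym2 V))).Reachable u v

/-- The minimum total weight of a spanning forest; for a connected graph, the weight of a minimum
spanning tree. -/
noncomputable def mstWeight {V : Type u} (E : Finset (Sym2 V)) (w : Sym2 V → ℕ) : ℕ :=
  sInf {x : ℕ | ∃ F : Finset (Sym2 V), IsSpanningForest E F ∧ ∑ e ∈ F, w e = x}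

/-- An incremental sequence of simple graphs of length `T` with edge weights in `{1, …, W}`. -/
structure IncrementalSeq (V : Type u) [DecidableEq V] (W T : ℕ) extends InsertionData V T where
  endpoint_mem : ∀ t ≤ T, ∀ e ∈ toInsertionData.edges t, ∀ v ∈ e, v ∈ toInsertionData.verts t
  loopless : ∀ e ∈ toInsertionData.edges T, ¬ e.IsDiag
  weight_mem : ∀ e ∈ toInsertionData.edges T, weight e ∈ Finset.Icc 1 W

namespace IncrementalSeq

variable {V : Type u} [DecidableEq V] {W T : ℕ}

/-- The minimum spanning tree weight of `G_t`. -/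
noncomputable def mst (S : IncrementalSeq V W T) (t : ℕ) : ℕ :=
  mstWeight (S.edges t) S.weight

/-- The difference sequence of the minimum spanning tree weight; the entry `i` is the one of
time `i + 1`. -/
noncomputable def diffMst (S : IncrementalSeq V W T) (i : Fin T) : ℝ :=
  (S.mst (i.val + 1) : ℝ) - (S.mst i.val : ℝ)

/-- Any two nodes of `G_t` are joined by a path, for each of the graphs `G_1, …, G_T`. -/
def AllConnected (S : IncrementalSeq V W T) : Prop :=
  ∀ t : ℕ, 1 ≤ t → t ≤ T → ∀ u ∈ S.verts t, ∀ v ∈ S.verts t,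
    (SimpleGraph.fromEdgeSet (S.edges t : Set (Sym2 V))).Reachable u v

/-- Edge-adjacency of incremental sequences (on event level): `S` and `S'` are equal, except that
at one time step `S` inserts one edge more than `S'`. -/
def EdgeAdj (S S' : IncrementalSeq V W T) : Prop :=
  S.initVerts = S'.initVerts ∧ S.initEdges = S'.initEdges ∧ S.insVerts = S'.insVerts ∧
    (∃ (e : Sym2 V) (i : Fin T), S'.insEdges i ⊆ S.insEdges i ∧
      S.insEdges i \ S'.insEdges i = {e} ∧ ∀ j ≠ i, S.insEdges j = S'.insEdges j) ∧
    ∀ e ∈ S'.edges T, S.weight e = S'.weight e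

/-- `S` and `S'` have the same initial graph and the same updates up to time `t`. -/
def AgreeUpTo (t : ℕ) (S S' : IncrementalSeq V W T) : Prop :=
  S.initVerts = S'.initVerts ∧ S.initEdges = S'.initEdges ∧
    (∀ i : Fin T, i.val < t → S.insVerts i = S'.insVerts i ∧ S.insEdges i = S'.insEdges i) ∧
    ∀ e ∈ S.edges t, S.weight e = S'.weight e

end IncrementalSeq

/-- A randomized algorithm that receives an incremental sequence and releases a real number at each
of the time steps `1, …, T`, given by the joint law of its outputs. The outputs up to time `t` do
not depend on updates after time `t`. -/
structure ContinualMechanism (V : Type u) [DecidableEq V] (W T : ℕ) where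
  law : IncrementalSeq V W T → Measure (Fin T → ℝ)
  isProbabilityMeasure : ∀ S, IsProbabilityMeasure (law S)
  causal : ∀ (t : ℕ) (S S' : IncrementalSeq V W T), S.AgreeUpTo t S' →
    (law S).map (fun (x : Fin T → ℝ) (i : {i : Fin T // i.val < t}) => x i) =
      (law S').map (fun (x : Fin T → ℝ) (i : {i : Fin T // i.val < t}) => x i)

/-- `ε`-edge-differential privacy. -/
def ContinualMechanism.EdgeDP {V : Type u} [DecidableEq V] {W T : ℕ}
    (A : ContinualMechanism V W T) (ε : ℝ) : Prop :=
  ∀ S S' : IncrementalSeq V W T, S.EdgeAdj S' ∨ S'.EdgeAdj S →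
    ∀ O : Set (Fin T → ℝ), MeasurableSet O →
      A.law S O ≤ ENNReal.ofReal (Real.exp ε) * A.law S' O

/-- The values `∑_{t=1}^T |Δf_S(t) - Δf_{S'}(t)|`, for `f` the minimum spanning tree weight, over
all edge-adjacent incremental sequences `S`, `S'` of connected graphs; the continuous global
sensitivity of `Δf` is the maximum of this set. -/
def diffMstDistances (V : Type u) [DecidableEq V] (W T : ℕ) : Set ℝ :=
  {x | ∃ S S' : IncrementalSeq V W T, S.AllConnected ∧ S'.AllConnected ∧ S.EdgeAdj S' ∧
    ∑ i : Fin T, |S.diffMst i - S'.diffMst i| = x}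

/-! Over 𝔽₂, the vectors `δ_u + δ_v` represent the cycle matroid: forests are independent sets, and
spanning forests are bases. Counting forest edges above each threshold `k` and using Kruskal's
greedy basis gives `mstWeight E w = ∑ k < W, (rank E - rank E_{≤k})` (`mstWeight_eq`). So an
additional edge `e` changes the weight by `W` times the indicator that `e` joins two components of
`E`, minus the sum over `w e ≤ k < W` of the same indicators for `E_{≤k}` (`mstWeight_insert_sub`).

As the graph grows, components only merge, so each indicator decreases in time. For adjacent
sequences the difference of the weights is thus a difference of two spikes: each is zero until `e`
arrives, then jumps up and afterwards only decreases. A spike of height at most `M` has total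
variation at most `2M` (`IsSpike.sum_abs_sub_le`). The heights are at most `W` and `W - 1`. In
connected graphs the first spike vanishes, which leaves `2(W - 1)`; an edge that first replaces one
of weight `W` and then becomes redundant attains this.

For the algorithm, the same bound holds along every monotone sampling of times, hence on every level
of a dyadic tree. The vector of dyadic increments therefore has ℓ¹-sensitivity at most `4W` times
the depth, and Laplace noise at the nodes makes it private. An output sums one node per level, which
gives error of order `W ε⁻¹ log^{3/2} T` with exponential tails. The bound `log δ⁻¹` tends to 0 as
`δ → 1`, so the noise must also have enough mass near 0; an independent uniform shift guarantees
this at no cost in privacy. -/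

/-! ### The cycle matroid over 𝔽₂ -/

/-- The vector `δ_u + δ_v` over `𝔽₂` of an edge `uv`. -/
noncomputable def edgeVec {V : Type u} : Sym2 V → (V →₀ ZMod 2) :=
  Sym2.lift ⟨fun u v => Finsupp.single u 1 + Finsupp.single v 1, fun _ _ => add_comm _ _⟩

@[simp]
theorem edgeVec_mk {V : Type u} (u v : V) :
    edgeVec s(u, v) = Finsupp.single u 1 + Finsupp.single v 1 := rfl

/-- The subspace over `𝔽₂` spanned by the vectors of a set of edges. -/
noncomputable def edgeSpan {V : Type u} (E : Set (Sym2 V)) : Submodule (ZMod 2) (V →₀ ZMod 2) :=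
  Submodule.span (ZMod 2) (edgeVec '' E)

theorem edgeSpan_mono {V : Type u} {E F : Set (Sym2 V)} (h : E ⊆ F) : edgeSpan E ≤ edgeSpan F :=
  Submodule.span_mono (Set.image_mono h)

theorem edgeVec_mem_edgeSpan {V : Type u} {E : Set (Sym2 V)} {e : Sym2 V} (h : e ∈ E) :
    edgeVec e ∈ edgeSpan E :=
  Submodule.subset_span (Set.mem_image_of_mem _ h)

theorem edgeVec_diag {V : Type u} (u : V) : edgeVec s(u, u) = 0 := by
  rw [edgeVec_mk, ← Finsupp.single_add]
  have : (1 + 1 : ZMod 2) = 0 := by decide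
  simp [this]

theorem edgeVec_add {V : Type u} (u v x : V) :
    edgeVec s(u, v) + edgeVec s(v, x) = edgeVec s(u, x) := by
  have h := edgeVec_diag v
  simp only [edgeVec_mk] at *
  calc _ = Finsupp.single u 1 + (Finsupp.single v (1 : ZMod 2) + Finsupp.single v 1)
      + Finsupp.single x 1 := by abel
    _ = _ := by rw [h, add_zero]

/-- Summing coordinates over the component of `u` is a functional that kills every edge of `E`, but
takes the value 1 on `uv` if `v` lies outside that component. Conversely, edge vectors telescope
along a walk. -/
theorem edgeVec_mem_edgeSpan_iff {V : Type u} {E : Set (Sym2 V)} {u v : V} :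
    edgeVec s(u, v) ∈ edgeSpan E ↔ (SimpleGraph.fromEdgeSet E).Reachable u v := by
  classical
  constructor
  · intro h
    by_contra hr
    let f : V → ZMod 2 := fun x => if (SimpleGraph.fromEdgeSet E).Reachable u x then 1 else 0
    let φ : (V →₀ ZMod 2) →ₗ[ZMod 2] ZMod 2 := Finsupp.linearCombination (ZMod 2) f
    have hφ : ∀ x y, φ (edgeVec s(x, y)) = f x + f y := by
      intro x y
      simp [φ, edgeVec_mk, Finsupp.linearCombination_single]
    have hle : edgeSpan E ≤ LinearMap.ker φ := by
      refine Submodule.span_le.2 ?_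
      rintro _ ⟨e, he, rfl⟩
      induction e with
      | h x y =>
        rw [SetLike.mem_coe, LinearMap.mem_ker, hφ]
        have hxy : f x = f y := by
          by_cases hne : x = y
          · rw [hne]
          have hadj : (SimpleGraph.fromEdgeSet E).Adj x y :=
            (SimpleGraph.fromEdgeSet_adj E).2 ⟨he, hne⟩
          have : (SimpleGraph.fromEdgeSet E).Reachable u x ↔
              (SimpleGraph.fromEdgeSet E).Reachable u y :=
            ⟨fun h => h.trans hadj.reachable, fun h => h.trans hadj.symm.reachable⟩
          simp only [f, this]
        rw [hxy]
        exact CharTwo.add_self_eq_zero _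
    have h1 := hle h
    rw [LinearMap.mem_ker, hφ] at h1
    simp [f, hr] at h1
  · rintro ⟨p⟩
    induction p with
    | nil => rw [edgeVec_diag]; exact Submodule.zero_mem _
    | cons hadj p ih =>
      rw [← edgeVec_add]
      exact Submodule.add_mem _
        (edgeVec_mem_edgeSpan ((SimpleGraph.fromEdgeSet_adj E).1 hadj).1) ih

/-- An edge is a bridge exactly when its vector is not in the span of the other edges; both sides
demand this of every edge. -/
theorem isAcyclic_iff_linearIndepOn_edgeVec {V : Type u} {F : Set (Sym2 V)}
    (hF : ∀ e ∈ F, ¬ e.IsDiag) :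
    (SimpleGraph.fromEdgeSet F).IsAcyclic ↔ LinearIndepOn (ZMod 2) edgeVec F := by
  rw [SimpleGraph.isAcyclic_iff_forall_adj_isBridge, linearIndepOn_iff_notMem_span]
  have key : ∀ u v, (SimpleGraph.fromEdgeSet F).IsBridge s(u, v) ↔
      edgeVec s(u, v) ∉ Submodule.span (ZMod 2) (edgeVec '' (F \ {s(u, v)})) := by
    intro u v
    rw [SimpleGraph.isBridge_iff, ← edgeSpan, edgeVec_mem_edgeSpan_iff,
      SimpleGraph.deleteEdges_fromEdgeSet]
  constructor
  · intro h e he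
    induction e with
    | h u v =>
      refine (key u v).1 (h ((SimpleGraph.fromEdgeSet_adj F).2 ⟨he, fun huv => hF _ he ?_⟩))
      simpa using huv
  · intro h u v hadj
    exact (key u v).2 (h _ ((SimpleGraph.fromEdgeSet_adj F).1 hadj).1)

/-- The rank of an edge set in the cycle matroid. -/
noncomputable def edgeRank {V : Type u} (E : Finset (Sym2 V)) : ℕ :=
  Module.finrank (ZMod 2) (edgeSpan (E : Set (Sym2 V)))

instance finiteDimensional_edgeSpan {V : Type u} (E : Finset (Sym2 V)) :
    FiniteDimensional (ZMod 2) (edgeSpan (E : Set (Sym2 V))) :=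
  FiniteDimensional.span_of_finite _ (E.finite_toSet.image _)

theorem card_eq_edgeRank {V : Type u} {F : Finset (Sym2 V)}
    (h : LinearIndepOn (ZMod 2) edgeVec (F : Set (Sym2 V))) : F.card = edgeRank F := by
  classical
  have h1 := finrank_span_eq_card (R := ZMod 2) h
  rw [edgeRank, edgeSpan, Set.image_eq_range, ← Fintype.card_coe]
  exact h1.symm

theorem edgeRank_mono {V : Type u} {E F : Finset (Sym2 V)}
    (h : edgeSpan (E : Set (Sym2 V)) ≤ edgeSpan (F : Set (Sym2 V))) : edgeRank E ≤ edgeRank F :=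
  Submodule.finrank_mono h

open Classical in
theorem edgeRank_insert {V : Type u} [DecidableEq V] (E : Finset (Sym2 V)) (e : Sym2 V) :
    edgeRank (insert e E) =
      edgeRank E + if edgeVec e ∈ edgeSpan (E : Set (Sym2 V)) then 0 else 1 := by
  -- A basis `B` of the span of `E` turns ranks into cardinalities.
  obtain ⟨B, hBE, -, hspan, hB⟩ := exists_linearIndepOn_extension (K := ZMod 2) (v := edgeVec)
    (linearIndepOn_empty (ZMod 2) edgeVec) (Set.empty_subset (E : Set (Sym2 V)))
  lift B to Finset (Sym2 V) using E.finite_toSet.subset hBE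
  have hle : edgeSpan (B : Set (Sym2 V)) = edgeSpan (E : Set (Sym2 V)) :=
    le_antisymm (edgeSpan_mono hBE) (Submodule.span_le.2 hspan)
  have hins : edgeSpan ((insert e E : Finset _) : Set (Sym2 V)) =
      edgeSpan ((insert e B : Finset _) : Set (Sym2 V)) := by
    simp only [edgeSpan, Finset.coe_insert, Set.image_insert_eq, Submodule.span_insert] at hle ⊢
    rw [hle]
  have hE : edgeRank E = edgeRank B := by rw [edgeRank, edgeRank, hle]
  have hI : edgeRank (insert e E) = edgeRank (insert e B) := by rw [edgeRank, edgeRank, hins]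
  rw [hE, hI, ← hle]
  split_ifs with h
  · have : edgeSpan ((insert e B : Finset _) : Set (Sym2 V)) = edgeSpan (B : Set (Sym2 V)) := by
      rw [Finset.coe_insert, edgeSpan, Set.image_insert_eq]
      exact Submodule.span_insert_eq_span h
    rw [edgeRank, this, edgeRank, add_zero]
  · have heB : e ∉ (B : Set (Sym2 V)) := fun he => h (edgeVec_mem_edgeSpan he)
    have hi : LinearIndepOn (ZMod 2) edgeVec ((insert e B : Finset _) : Set (Sym2 V)) := by
      rw [Finset.coe_insert, linearIndepOn_insert heB]
      exact ⟨hB, h⟩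
    rw [← card_eq_edgeRank hi, ← card_eq_edgeRank hB,
      Finset.card_insert_of_notMem (by simpa using heB)]

theorem isSpanningForest_iff {V : Type u} {E F : Finset (Sym2 V)} (hE : ∀ e ∈ E, ¬ e.IsDiag) :
    IsSpanningForest E F ↔ F ⊆ E ∧ LinearIndepOn (ZMod 2) edgeVec (F : Set (Sym2 V)) ∧
      edgeSpan (F : Set (Sym2 V)) = edgeSpan (E : Set (Sym2 V)) := by
  unfold IsSpanningForest
  refine and_congr_right fun hFE => ?_
  rw [isAcyclic_iff_linearIndepOn_edgeVec fun e he => hE e (hFE (by simpa using he))]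
  refine and_congr_right fun _ => ?_
  constructor
  · intro h
    refine le_antisymm (edgeSpan_mono (by simpa using hFE)) (Submodule.span_le.2 ?_)
    rintro _ ⟨e, he, rfl⟩
    induction e with
    | h u v =>
      exact edgeVec_mem_edgeSpan_iff.2
        (h u v (edgeVec_mem_edgeSpan_iff.1 (edgeVec_mem_edgeSpan he)))
  · intro h u v
    rw [← edgeVec_mem_edgeSpan_iff, ← edgeVec_mem_edgeSpan_iff, h]
    exact id

/-! ### The minimum spanning forest weight as a sum of ranks -/

/-- The edges of weight at most `k`. -/
def edgesLE {V : Type u} (E : Finset (Sym2 V)) (w : Sym2 V → ℕ) (k : ℕ) : Finset (Sym2 V) :=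
  E.filter fun e => w e ≤ k

theorem edgesLE_subset {V : Type u} (E : Finset (Sym2 V)) (w : Sym2 V → ℕ) (k : ℕ) :
    edgesLE E w k ⊆ E :=
  Finset.filter_subset _ _

theorem edgesLE_mono {V : Type u} {E F : Finset (Sym2 V)} (h : E ⊆ F) (w : Sym2 V → ℕ) (k : ℕ) :
    edgesLE E w k ⊆ edgesLE F w k :=
  Finset.filter_subset_filter _ h

theorem sum_weight_eq {V : Type u} {F : Finset (Sym2 V)} {w : Sym2 V → ℕ} {W : ℕ}
    (hw : ∀ e ∈ F, w e ≤ W) :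
    ∑ e ∈ F, w e = ∑ k ∈ Finset.range W, (F.card - (edgesLE F w k).card) := by
  have h1 : ∀ e ∈ F, w e = ∑ k ∈ Finset.range W, if w e ≤ k then 0 else 1 := by
    intro e he
    have h2 : (Finset.range W).filter (fun k => ¬ w e ≤ k) = Finset.range (w e) := by
      ext k
      have := hw e he
      simp only [Finset.mem_filter, Finset.mem_range]
      omega
    refine (Finset.card_range (w e)).symm.trans ?_
    rw [← h2, Finset.card_filter]
    exact Finset.sum_congr rfl fun k _ => ite_not ..
  rw [Finset.sum_congr rfl h1, Finset.sum_comm]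
  refine Finset.sum_congr rfl fun k _ => ?_
  have h4 := Finset.card_filter_add_card_filter_not (s := F) (fun e => w e ≤ k)
  have h5 : ∑ e ∈ F, (if w e ≤ k then 0 else 1) = (F.filter fun e => ¬ w e ≤ k).card := by
    rw [Finset.card_filter]
    exact Finset.sum_congr rfl fun e _ => (ite_not ..).symm
  rw [h5, edgesLE]
  omega

/-- Kruskal's algorithm: a basis for threshold `n` extends to one for `n + 1`, so a single forest
spans every threshold graph at once. -/
theorem exists_greedy_forest {V : Type u} (E : Finset (Sym2 V)) (w : Sym2 V → ℕ) (n : ℕ) :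
    ∃ F ⊆ edgesLE E w n, LinearIndepOn (ZMod 2) edgeVec (F : Set (Sym2 V)) ∧
      ∀ k ≤ n, edgeSpan (edgesLE F w k : Set (Sym2 V)) =
        edgeSpan (edgesLE E w k : Set (Sym2 V)) := by
  classical
  have ext : ∀ (B : Finset (Sym2 V)) (k : ℕ), B ⊆ edgesLE E w k →
      LinearIndepOn (ZMod 2) edgeVec (B : Set (Sym2 V)) →
      ∃ F ⊆ edgesLE E w k, B ⊆ F ∧ LinearIndepOn (ZMod 2) edgeVec (F : Set (Sym2 V)) ∧
        edgeSpan (edgesLE F w k : Set (Sym2 V)) = edgeSpan (edgesLE E w k : Set (Sym2 V)) := by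
    intro B k hBE hB
    obtain ⟨F, hFE, hBF, hspan, hF⟩ := exists_linearIndepOn_extension hB (Finset.coe_subset.2 hBE)
    lift F to Finset (Sym2 V) using (edgesLE E w k).finite_toSet.subset hFE
    rw [Finset.coe_subset] at hFE hBF
    refine ⟨F, hFE, hBF, hF, ?_⟩
    have : edgesLE F w k = F :=
      Finset.filter_true_of_mem fun e he => (Finset.mem_filter.1 (hFE he)).2
    rw [this]
    exact le_antisymm (edgeSpan_mono (Finset.coe_subset.2 hFE)) (Submodule.span_le.2 hspan)
  induction n with
  | zero =>
    obtain ⟨F, hFE, -, hF, hspan⟩ := ext ∅ 0 (Finset.empty_subset _) (by simp)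
    refine ⟨F, hFE, hF, fun k hk => ?_⟩
    obtain rfl : k = 0 := by omega
    exact hspan
  | succ n ih =>
    obtain ⟨B, hBE, hB, hBspan⟩ := ih
    have hmono : edgesLE E w n ⊆ edgesLE E w (n + 1) :=
      Finset.monotone_filter_right _ fun e _ he => Nat.le_succ_of_le he
    obtain ⟨F, hFE, hBF, hF, hspan⟩ := ext B (n + 1) (hBE.trans hmono) hB
    refine ⟨F, hFE, hF, fun k hk => ?_⟩
    rcases Nat.lt_or_ge k (n + 1) with hlt | hge
    · refine le_antisymm (edgeSpan_mono (Finset.coe_subset.2 (edgesLE_mono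
        (hFE.trans (Finset.filter_subset _ _)) w k))) ?_
      rw [← hBspan k (by omega)]
      exact edgeSpan_mono (Finset.coe_subset.2 (edgesLE_mono hBF w k))
    · obtain rfl : k = n + 1 := by omega
      exact hspan

/-- The summand for `k` counts forest edges heavier than `k`. Any spanning forest has at most
`edgeRank (edgesLE E w k)` edges of weight at most `k`, by independence; the greedy forest attains
this for all `k` simultaneously. -/
theorem mstWeight_eq {V : Type u} {E : Finset (Sym2 V)} {w : Sym2 V → ℕ} {W : ℕ}
    (hE : ∀ e ∈ E, ¬ e.IsDiag) (hw : ∀ e ∈ E, w e ≤ W) :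
    mstWeight E w = ∑ k ∈ Finset.range W, (edgeRank E - edgeRank (edgesLE E w k)) := by
  have hEW : edgesLE E w W = E := Finset.filter_true_of_mem hw
  obtain ⟨F, hFE, hF, hspan⟩ := exists_greedy_forest E w W
  rw [hEW] at hFE
  have hFW : edgesLE F w W = F := Finset.filter_true_of_mem fun e he => hw e (hFE he)
  have hFspan : edgeSpan (F : Set (Sym2 V)) = edgeSpan (E : Set (Sym2 V)) := by
    simpa only [hEW, hFW] using hspan W le_rfl
  have hforest : IsSpanningForest E F := (isSpanningForest_iff hE).2 ⟨hFE, hF, hFspan⟩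
  refine le_antisymm ?_ ?_
  · refine Nat.sInf_le ⟨F, hforest, ?_⟩
    rw [sum_weight_eq fun e he => hw e (hFE he)]
    refine Finset.sum_congr rfl fun k hk => ?_
    have h1 : F.card = edgeRank E := by rw [card_eq_edgeRank hF, edgeRank, edgeRank, hFspan]
    have h2 : (edgesLE F w k).card = edgeRank (edgesLE E w k) := by
      rw [card_eq_edgeRank (hF.mono (Finset.coe_subset.2 (edgesLE_subset _ _ _))),
        edgeRank, edgeRank, hspan k (Finset.mem_range.1 hk).le]
    rw [h1, h2]
  · refine le_csInf ⟨_, F, hforest, rfl⟩ ?_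
    rintro _ ⟨F, hF, rfl⟩
    obtain ⟨hFE, hFi, hspan⟩ := (isSpanningForest_iff hE).1 hF
    rw [sum_weight_eq fun e he => hw e (hFE he)]
    refine Finset.sum_le_sum fun k _ => ?_
    have h1 : F.card = edgeRank E := by rw [card_eq_edgeRank hFi, edgeRank, edgeRank, hspan]
    have h2 : (edgesLE F w k).card ≤ edgeRank (edgesLE E w k) := by
      rw [card_eq_edgeRank (hFi.mono (Finset.coe_subset.2 (edgesLE_subset _ _ _)))]
      exact edgeRank_mono (edgeSpan_mono (Finset.coe_subset.2 (edgesLE_mono hFE w k)))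
    omega

theorem mstWeight_congr {V : Type u} {E : Finset (Sym2 V)} {w w' : Sym2 V → ℕ}
    (h : ∀ e ∈ E, w e = w' e) : mstWeight E w = mstWeight E w' := by
  unfold mstWeight
  congr 1
  ext x
  refine exists_congr fun F => and_congr_right fun hF => ?_
  rw [Finset.sum_congr rfl fun e he => h e (hF.1 he)]

/-! ### The effect of one additional edge -/

open Classical in
/-- The indicator that an edge joins two different components of a graph. -/
noncomputable def joinInd {V : Type u} (E : Finset (Sym2 V)) (e : Sym2 V) : ℝ :=
  if edgeVec e ∈ edgeSpan (E : Set (Sym2 V)) then 0 else 1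

theorem joinInd_nonneg {V : Type u} (E : Finset (Sym2 V)) (e : Sym2 V) : 0 ≤ joinInd E e := by
  unfold joinInd; split_ifs <;> norm_num

theorem joinInd_le_one {V : Type u} (E : Finset (Sym2 V)) (e : Sym2 V) : joinInd E e ≤ 1 := by
  unfold joinInd; split_ifs <;> norm_num

theorem joinInd_anti {V : Type u} {E F : Finset (Sym2 V)} (h : E ⊆ F) (e : Sym2 V) :
    joinInd F e ≤ joinInd E e := by
  by_cases he : edgeVec e ∈ edgeSpan (E : Set (Sym2 V))
  · have : joinInd F e = 0 := if_pos (edgeSpan_mono (Finset.coe_subset.2 h) he)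
    rw [this]
    exact joinInd_nonneg _ _
  · have : joinInd E e = 1 := if_neg he
    rw [this]
    exact joinInd_le_one _ _

theorem edgeRank_insert_real {V : Type u} [DecidableEq V] (E : Finset (Sym2 V)) (e : Sym2 V) :
    (edgeRank (insert e E) : ℝ) = edgeRank E + joinInd E e := by
  rw [edgeRank_insert, joinInd]
  split_ifs <;> simp

theorem mstWeight_insert_sub {V : Type u} [DecidableEq V] {E : Finset (Sym2 V)} {e : Sym2 V}
    {w : Sym2 V → ℕ} {W : ℕ} (hE : ∀ f ∈ insert e E, ¬ f.IsDiag) (hw : ∀ f ∈ insert e E, w f ≤ W) :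
    (mstWeight (insert e E) w : ℝ) - mstWeight E w =
      W * joinInd E e -
        ∑ k ∈ Finset.range W, if w e ≤ k then joinInd (edgesLE E w k) e else 0 := by
  have cast : ∀ F ⊆ insert e E, (mstWeight F w : ℝ) =
      ∑ k ∈ Finset.range W, ((edgeRank F : ℝ) - edgeRank (edgesLE F w k)) := by
    intro F hF
    rw [mstWeight_eq (fun f hf => hE f (hF hf)) (fun f hf => hw f (hF hf)), Nat.cast_sum]
    refine Finset.sum_congr rfl fun k _ => Nat.cast_sub ?_
    exact edgeRank_mono (edgeSpan_mono (Finset.coe_subset.2 (edgesLE_subset _ _ _)))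
  rw [cast _ subset_rfl, cast E (Finset.subset_insert _ _), ← Finset.sum_sub_distrib]
  have hW : (W : ℝ) * joinInd E e = ∑ k ∈ Finset.range W, joinInd E e := by simp
  rw [hW, ← Finset.sum_sub_distrib]
  refine Finset.sum_congr rfl fun k _ => ?_
  rw [edgeRank_insert_real, edgesLE, Finset.filter_insert]
  split_ifs
  · rw [edgeRank_insert_real, edgesLE]; ring
  · rw [edgesLE]; ring

/-! ### Total variation of spikes -/

/-- A function that vanishes up to some time, then jumps to a value in `[0, M]`, and decreases
from there on without becoming negative. -/
structure IsSpike (p : ℕ → Prop) (h : ℕ → ℝ) (M : ℝ) : Prop where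
  mono : ∀ s t, s ≤ t → p s → p t
  eq_zero : ∀ t, ¬ p t → h t = 0
  anti : ∀ s t, s ≤ t → p s → h t ≤ h s
  nonneg : ∀ t, 0 ≤ h t
  le : ∀ t, h t ≤ M

/-- Lets the variation bound be applied on the grid of each dyadic level. -/
theorem IsSpike.comp {p : ℕ → Prop} {h : ℕ → ℝ} {M : ℝ} (hs : IsSpike p h M) {τ : ℕ → ℕ}
    (hτ : Monotone τ) : IsSpike (p ∘ τ) (h ∘ τ) M :=
  ⟨fun _ _ h => hs.mono _ _ (hτ h), fun _ => hs.eq_zero _, fun _ _ h => hs.anti _ _ (hτ h),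
    fun _ => hs.nonneg _, fun _ => hs.le _⟩

theorem IsSpike.sum_abs_sub_le {p : ℕ → Prop} {h : ℕ → ℝ} {M : ℝ} (hs : IsSpike p h M) (N : ℕ) :
    ∑ q ∈ Finset.range N, |h (q + 1) - h q| ≤ 2 * M := by
  -- The term `- h N` reserves what the remaining descent can still cost; before the jump nothing
  -- has been spent.
  have key : (∑ q ∈ Finset.range N, |h (q + 1) - h q| ≤ 2 * M - h N) ∧
      (¬ p N → ∑ q ∈ Finset.range N, |h (q + 1) - h q| = 0) := by
    induction N with
    | zero =>
      have h1 := hs.nonneg 0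
      have h2 := hs.le 0
      refine ⟨?_, fun _ => by simp⟩
      rw [Finset.sum_range_zero]
      linarith
    | succ N ih =>
      rw [Finset.sum_range_succ]
      by_cases hp : p N
      · have h1 := hs.anti N (N + 1) (Nat.le_succ N) hp
        rw [abs_of_nonpos (by linarith)]
        exact ⟨by linarith [ih.1], fun hn => absurd (hs.mono N _ (Nat.le_succ N) hp) hn⟩
      · rw [ih.2 hp, hs.eq_zero N hp, sub_zero, abs_of_nonneg (hs.nonneg _), zero_add]
        exact ⟨by linarith [hs.le (N + 1)], hs.eq_zero _⟩
  linarith [key.1, hs.nonneg N]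

/-! ### Adjacent incremental sequences -/

namespace InsertionData

variable {V : Type u} [DecidableEq V] {T : ℕ}

theorem edges_mono (S : InsertionData V T) {s t : ℕ} (h : s ≤ t) : S.edges s ⊆ S.edges t := by
  refine Finset.union_subset_union_right (Finset.biUnion_subset_biUnion_of_subset_left _ ?_)
  exact Finset.monotone_filter_right _ fun i _ hi => lt_of_lt_of_le hi h

/-- Holds for every `t`, since the graph stays constant after time `T`; the dyadic grids run past
`T`. -/
theorem edges_subset_edges_length (S : InsertionData V T) (t : ℕ) : S.edges t ⊆ S.edges T := by
  refine Finset.union_subset_union_right (Finset.biUnion_subset_biUnion_of_subset_left _ ?_)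
  exact Finset.monotone_filter_right _ fun i _ _ => i.isLt

theorem mem_edges (S : InsertionData V T) {t : ℕ} {e : Sym2 V} :
    e ∈ S.edges t ↔ e ∈ S.initEdges ∨ ∃ i : Fin T, i.val < t ∧ e ∈ S.insEdges i := by
  simp [edges]

end InsertionData

namespace IncrementalSeq

variable {V : Type u} [DecidableEq V] {W T : ℕ}

/-- The sequence `S` arises from `S'` by inserting the edge `e` at time `i + 1` in addition. -/
structure InsertsAlso (S S' : IncrementalSeq V W T) (e : Sym2 V) (i : Fin T) : Prop where
  verts_eq : ∀ t, S.verts t = S'.verts t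
  edges_of_le : ∀ t ≤ i.val, S.edges t = S'.edges t
  edges_of_lt : ∀ t, i.val < t → S.edges t = insert e (S'.edges t)
  weight_eq : ∀ f ∈ S'.edges T, S.weight f = S'.weight f

theorem EdgeAdj.insertsAlso {S S' : IncrementalSeq V W T} (h : S.EdgeAdj S') :
    ∃ e i, S.InsertsAlso S' e i ∧ S.insEdges i \ S'.insEdges i = {e} := by
  obtain ⟨hV, hE, hiV, ⟨e, i, hsub, hsd, hj⟩, hw⟩ := h
  have hi : ∀ f, f ∈ S.insEdges i ↔ f = e ∨ f ∈ S'.insEdges i := by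
    intro f
    have h1 : f ∈ S.insEdges i \ S'.insEdges i ↔ f = e := by rw [hsd, Finset.mem_singleton]
    rw [Finset.mem_sdiff] at h1
    have h2 := @hsub f
    tauto
  refine ⟨e, i, ⟨fun t => ?_, fun t ht => ?_, fun t ht => ?_, hw⟩, hsd⟩
  · rw [InsertionData.verts, InsertionData.verts, hV, hiV]
  · ext f
    rw [InsertionData.mem_edges, InsertionData.mem_edges, hE]
    refine or_congr_right (exists_congr fun j => and_congr_right fun hjt => ?_)
    rw [hj j (by rintro rfl; omega)]
  · ext f
    rw [Finset.mem_insert, InsertionData.mem_edges, InsertionData.mem_edges, hE]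
    constructor
    · rintro (h | ⟨j, hjt, hf⟩)
      · exact Or.inr (Or.inl h)
      · by_cases hji : j = i
        · subst hji
          rcases (hi f).1 hf with h | h
          · exact Or.inl h
          · exact Or.inr (Or.inr ⟨j, hjt, h⟩)
        · exact Or.inr (Or.inr ⟨j, hjt, by rwa [← hj j hji]⟩)
    · rintro (rfl | h | ⟨j, hjt, hf⟩)
      · exact Or.inr ⟨i, ht, (hi f).2 (Or.inl rfl)⟩
      · exact Or.inl h
      · by_cases hji : j = i
        · subst hji
          exact Or.inr ⟨j, hjt, hsub hf⟩
        · exact Or.inr ⟨j, hjt, by rwa [hj j hji]⟩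

namespace InsertsAlso

variable {S S' : IncrementalSeq V W T} {e : Sym2 V} {i : Fin T}

theorem mst_eq_of_le (h : S.InsertsAlso S' e i) {t : ℕ} (ht : t ≤ i.val) : S.mst t = S'.mst t := by
  rw [mst, mst, h.edges_of_le t ht]
  exact mstWeight_congr fun f hf => h.weight_eq f (S'.edges_subset_edges_length t hf)

theorem mem_edges (h : S.InsertsAlso S' e i) {t : ℕ} (ht : i.val < t) : e ∈ S.edges t := by
  rw [h.edges_of_lt t ht]
  exact Finset.mem_insert_self _ _

theorem one_le_weight (h : S.InsertsAlso S' e i) : 1 ≤ S.weight e :=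
  (Finset.mem_Icc.1 (S.weight_mem e (h.mem_edges i.isLt))).1

theorem mst_sub_of_lt (h : S.InsertsAlso S' e i) {t : ℕ} (ht : i.val < t) :
    (S.mst t : ℝ) - S'.mst t = W * joinInd (S'.edges t) e -
      ∑ k ∈ Finset.range W,
        if S.weight e ≤ k then joinInd (edgesLE (S'.edges t) S.weight k) e else 0 := by
  have h1 : S'.mst t = mstWeight (S'.edges t) S.weight := by
    rw [mst]
    exact mstWeight_congr fun f hf => (h.weight_eq f (S'.edges_subset_edges_length t hf)).symm
  rw [h1, mst, h.edges_of_lt t ht]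
  have hsub : insert e (S'.edges t) ⊆ S.edges T := by
    rw [← h.edges_of_lt t ht]
    exact S.edges_subset_edges_length t
  exact mstWeight_insert_sub (fun f hf => S.loopless f (hsub hf))
    (fun f hf => (Finset.mem_Icc.1 (S.weight_mem f (hsub hf))).2)

/-- The first part of the difference of the minimum spanning tree weights. -/
noncomputable def joinPart (S' : IncrementalSeq V W T) (e : Sym2 V) (i : Fin T) (t : ℕ) : ℝ :=
  if i.val < t then W * joinInd (S'.edges t) e else 0

/-- The second part of the difference of the minimum spanning tree weights. -/
noncomputable def cyclePart (S S' : IncrementalSeq V W T) (e : Sym2 V) (i : Fin T) (t : ℕ) : ℝ :=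
  if i.val < t then ∑ k ∈ Finset.range W,
    if S.weight e ≤ k then joinInd (edgesLE (S'.edges t) S.weight k) e else 0 else 0

theorem mst_sub (h : S.InsertsAlso S' e i) (t : ℕ) :
    (S.mst t : ℝ) - S'.mst t = joinPart S' e i t - cyclePart S S' e i t := by
  unfold joinPart cyclePart
  split_ifs with ht
  · exact h.mst_sub_of_lt ht
  · rw [h.mst_eq_of_le (not_lt.1 ht)]; simp

theorem isSpike_joinPart : IsSpike (fun t => i.val < t) (joinPart S' e i) W where
  mono _ _ hst hs := lt_of_lt_of_le hs hst
  eq_zero _ ht := if_neg ht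
  anti s t hst hs := by
    rw [joinPart, joinPart, if_pos hs, if_pos (lt_of_lt_of_le hs hst)]
    exact mul_le_mul_of_nonneg_left (joinInd_anti (S'.edges_mono hst) e) (Nat.cast_nonneg _)
  nonneg t := by
    rw [joinPart]
    split_ifs
    · exact mul_nonneg (Nat.cast_nonneg _) (joinInd_nonneg _ _)
    · exact le_rfl
  le t := by
    rw [joinPart]
    split_ifs
    · exact mul_le_of_le_one_right (Nat.cast_nonneg _) (joinInd_le_one _ _)
    · exact Nat.cast_nonneg _

theorem isSpike_cyclePart (h : S.InsertsAlso S' e i) (hW : 1 ≤ W) :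
    IsSpike (fun t => i.val < t) (cyclePart S S' e i) (W - 1) where
  mono _ _ hst hs := lt_of_lt_of_le hs hst
  eq_zero _ ht := if_neg ht
  anti s t hst hs := by
    rw [cyclePart, cyclePart, if_pos hs, if_pos (lt_of_lt_of_le hs hst)]
    refine Finset.sum_le_sum fun k _ => ?_
    split_ifs
    · exact joinInd_anti (edgesLE_mono (S'.edges_mono hst) _ _) e
    · exact le_rfl
  nonneg t := by
    rw [cyclePart]
    split_ifs
    · refine Finset.sum_nonneg fun k _ => ?_
      split_ifs
      · exact joinInd_nonneg _ _
      · exact le_rfl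
    · exact le_rfl
  le t := by
    have hW' : (1 : ℝ) ≤ W := by exact_mod_cast hW
    obtain ⟨n, rfl⟩ : ∃ n, W = n + 1 := ⟨W - 1, by omega⟩
    rw [cyclePart]
    split_ifs
    -- The threshold `k = 0` contributes nothing because `e` has weight at least 1; this is why the
    -- height is `W - 1` and not `W`.
    · rw [Finset.sum_range_succ', if_neg (by have := h.one_le_weight; omega), add_zero]
      calc _ ≤ ∑ k ∈ Finset.range n, (1 : ℝ) := Finset.sum_le_sum fun k _ => by
            split_ifs
            · exact joinInd_le_one _ _
            · norm_num
        _ = _ := by simp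
    · linarith

/-- The two spikes cost `2W` and `2(W - 1)`. -/
theorem sum_abs_le (h : S.InsertsAlso S' e i) (hW : 1 ≤ W) {τ : ℕ → ℕ} (hτ : Monotone τ) (N : ℕ) :
    ∑ q ∈ Finset.range N, |((S.mst (τ (q + 1)) : ℝ) - S.mst (τ q)) -
      (S'.mst (τ (q + 1)) - S'.mst (τ q))| ≤ 4 * W := by
  have h1 := ((isSpike_joinPart (S' := S') (e := e) (i := i)).comp hτ).sum_abs_sub_le N
  have h2 := ((h.isSpike_cyclePart hW).comp hτ).sum_abs_sub_le N
  have h3 : ∀ q, |((S.mst (τ (q + 1)) : ℝ) - S.mst (τ q)) - (S'.mst (τ (q + 1)) - S'.mst (τ q))| ≤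
      |joinPart S' e i (τ (q + 1)) - joinPart S' e i (τ q)| +
        |cyclePart S S' e i (τ (q + 1)) - cyclePart S S' e i (τ q)| := by
    intro q
    have e1 := h.mst_sub (τ (q + 1))
    have e2 := h.mst_sub (τ q)
    refine le_trans (le_of_eq ?_) (abs_sub _ _)
    congr 1
    linarith
  refine (Finset.sum_le_sum fun q _ => h3 q).trans ?_
  rw [Finset.sum_add_distrib]
  simp only [Function.comp] at h1 h2
  linarith

/-- The endpoints of `e` are already nodes of `S'` at time `i + 1`, so the connected graph there
joins them without `e`, and they stay joined. -/
theorem joinPart_eq_zero (h : S.InsertsAlso S' e i) (hS' : S'.AllConnected) (t : ℕ) :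
    joinPart S' e i t = 0 := by
  rw [joinPart]
  split_ifs with ht
  swap
  · rfl
  have hmem : edgeVec e ∈ edgeSpan (S'.edges t : Set (Sym2 V)) := by
    induction e with
    | h u v =>
      have hv : ∀ x ∈ s(u, v), x ∈ S'.verts (i.val + 1) := fun x hx => by
        rw [← h.verts_eq]
        exact S.endpoint_mem _ i.isLt _ (h.mem_edges (Nat.lt_succ_self _)) x hx
      have := hS' (i.val + 1) (by omega) i.isLt u (hv u (Sym2.mem_mk_left _ _)) v
        (hv v (Sym2.mem_mk_right _ _))
      exact edgeSpan_mono (Finset.coe_subset.2 (S'.edges_mono ht)) (edgeVec_mem_edgeSpan_iff.2 this)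
  rw [joinInd, if_pos hmem, mul_zero]

theorem mst_sub_of_connected (h : S.InsertsAlso S' e i) (hS' : S'.AllConnected) (t : ℕ) :
    (S.mst t : ℝ) - S'.mst t = - cyclePart S S' e i t := by
  rw [h.mst_sub, h.joinPart_eq_zero hS', zero_sub]

theorem sum_diffMst_le (h : S.InsertsAlso S' e i) (hW : 1 ≤ W) (hS' : S'.AllConnected) :
    ∑ j : Fin T, |S.diffMst j - S'.diffMst j| ≤ 2 * W - 2 := by
  have h2 := (h.isSpike_cyclePart hW).sum_abs_sub_le T
  rw [Finset.sum_range] at h2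
  refine le_trans (le_of_eq (Finset.sum_congr rfl fun j _ => ?_)) (h2.trans (by linarith))
  have e1 := h.mst_sub_of_connected hS' (j.val + 1)
  have e2 := h.mst_sub_of_connected hS' j.val
  rw [diffMst, diffMst, ← abs_neg]
  congr 1
  linarith

end InsertsAlso

theorem upperBound_diffMstDistances (V : Type u) [DecidableEq V] (W T : ℕ) (hW : 1 ≤ W) :
    2 * (W : ℝ) - 2 ∈ upperBounds (diffMstDistances V W T) := by
  rintro _ ⟨S, S', -, hS', hadj, rfl⟩
  obtain ⟨e, i, h, -⟩ := hadj.insertsAlso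
  exact h.sum_diffMst_le hW hS'

end IncrementalSeq

/-! ### A pair attaining `2W - 2` -/

namespace IncrementalSeq

/-- Two paths `u x v` and `u y v`, the first with a heavy edge `xv`, the last edge `yv` of the
second inserted at time `2`; at time `1` the edges in `B` are inserted. -/
def twoPathsData {V : Type u} [DecidableEq V] (u v x y : V) (W T : ℕ) (B : Finset (Sym2 V)) :
    InsertionData V T where
  initVerts := {u, v, x, y}
  initEdges := {s(u, x), s(x, v), s(u, y)}
  insVerts _ := ∅
  insEdges j := if j.val = 0 then B else if j.val = 1 then {s(y, v)} else ∅
  weight f := if f = s(x, v) then W else 1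

theorem mem_edges_twoPathsData {V : Type u} [DecidableEq V] {u v x y : V} {W T : ℕ}
    {B : Finset (Sym2 V)} (hT : 2 ≤ T) {t : ℕ} {f : Sym2 V} :
    f ∈ (twoPathsData u v x y W T B).edges t ↔
      f = s(u, x) ∨ f = s(x, v) ∨ f = s(u, y) ∨ (1 ≤ t ∧ f ∈ B) ∨ (2 ≤ t ∧ f = s(y, v)) := by
  rw [InsertionData.mem_edges]
  constructor
  · rintro (h | ⟨j, hj, hf⟩)
    · simp only [twoPathsData, Finset.mem_insert, Finset.mem_singleton] at h
      tauto
    · simp only [twoPathsData] at hf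
      split_ifs at hf with h0 h1
      · exact Or.inr (Or.inr (Or.inr (Or.inl ⟨by omega, hf⟩)))
      · exact Or.inr (Or.inr (Or.inr (Or.inr ⟨by omega, Finset.mem_singleton.1 hf⟩)))
      · simp at hf
  · rintro (h | h | h | ⟨ht, h⟩ | ⟨ht, h⟩)
    · exact Or.inl (by simp [twoPathsData, h])
    · exact Or.inl (by simp [twoPathsData, h])
    · exact Or.inl (by simp [twoPathsData, h])
    · exact Or.inr ⟨⟨0, by omega⟩, ht, by simpa [twoPathsData] using h⟩
    · exact Or.inr ⟨⟨1, by omega⟩, ht, by simpa [twoPathsData] using h⟩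

theorem verts_twoPathsData {V : Type u} [DecidableEq V] {u v x y : V} {W T : ℕ}
    {B : Finset (Sym2 V)} {t : ℕ} :
    (twoPathsData u v x y W T B).verts t = {u, v, x, y} := by
  ext z
  simp [InsertionData.verts, twoPathsData]

/-- The data of two paths as an incremental sequence. -/
def twoPaths {V : Type u} [DecidableEq V] {u v x y : V} (hd : [u, v, x, y].Nodup) {W T : ℕ}
    (hW : 1 ≤ W) (hT : 2 ≤ T) {B : Finset (Sym2 V)} (hB : B ⊆ {s(u, v)}) :
    IncrementalSeq V W T where
  toInsertionData := twoPathsData u v x y W T B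
  endpoint_mem t _ f hf z hz := by
    rw [verts_twoPathsData]
    rw [mem_edges_twoPathsData hT] at hf
    have hB' : f ∈ B → f = s(u, v) := fun h => Finset.mem_singleton.1 (hB h)
    simp only [Finset.mem_insert, Finset.mem_singleton]
    have hcases : f = s(u, x) ∨ f = s(x, v) ∨ f = s(u, y) ∨ f = s(u, v) ∨ f = s(y, v) := by tauto
    rcases hcases with rfl | rfl | rfl | rfl | rfl <;> rw [Sym2.mem_iff] at hz <;> tauto
  loopless f hf := by
    rw [mem_edges_twoPathsData hT] at hf
    have hB' : f ∈ B → f = s(u, v) := fun h => Finset.mem_singleton.1 (hB h)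
    simp only [List.nodup_cons, List.mem_cons, List.not_mem_nil, or_false, not_or] at hd
    have hcases : f = s(u, x) ∨ f = s(x, v) ∨ f = s(u, y) ∨ f = s(u, v) ∨ f = s(y, v) := by tauto
    rcases hcases with rfl | rfl | rfl | rfl | rfl <;> rw [Sym2.mk_isDiag_iff] <;> tauto
  weight_mem f _ := by
    simp only [twoPathsData]
    split_ifs <;> simp [hW]

theorem allConnected_twoPaths {V : Type u} [DecidableEq V] {u v x y : V}
    (hd : [u, v, x, y].Nodup) {W T : ℕ} (hW : 1 ≤ W) (hT : 2 ≤ T) {B : Finset (Sym2 V)}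
    (hB : B ⊆ {s(u, v)}) : (twoPaths hd hW hT hB).AllConnected := by
  intro t _ _
  have hmem : ∀ f, f = s(u, x) ∨ f = s(x, v) ∨ f = s(u, y) →
      f ∈ ((twoPaths hd hW hT hB).edges t : Set (Sym2 V)) := by
    intro f hf
    rw [Finset.mem_coe]
    refine (mem_edges_twoPathsData hT).2 ?_
    tauto
  have hu : ∀ z ∈ (twoPaths hd hW hT hB).verts t,
      (SimpleGraph.fromEdgeSet ((twoPaths hd hW hT hB).edges t : Set (Sym2 V))).Reachable u z := by
    intro z hz
    have hz' : z ∈ (twoPathsData u v x y W T B).verts t := hz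
    rw [verts_twoPathsData] at hz'
    simp only [Finset.mem_insert, Finset.mem_singleton] at hz'
    have hux := edgeVec_mem_edgeSpan (hmem s(u, x) (by tauto))
    have hxv := edgeVec_mem_edgeSpan (hmem s(x, v) (by tauto))
    have huy := edgeVec_mem_edgeSpan (hmem s(u, y) (by tauto))
    rcases hz' with rfl | rfl | rfl | rfl
    · exact SimpleGraph.Reachable.refl _
    · rw [← edgeVec_mem_edgeSpan_iff, ← edgeVec_add u x z]
      exact Submodule.add_mem _ hux hxv
    · exact edgeVec_mem_edgeSpan_iff.1 hux
    · exact edgeVec_mem_edgeSpan_iff.1 huy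
  intro a ha b hb
  exact (hu a ha).symm.trans (hu b hb)

theorem edgeAdj_twoPaths {V : Type u} [DecidableEq V] {u v x y : V}
    (hd : [u, v, x, y].Nodup) {W T : ℕ} (hW : 1 ≤ W) (hT : 2 ≤ T) :
    (twoPaths hd hW hT (subset_refl {s(u, v)})).EdgeAdj
      (twoPaths hd hW hT (Finset.empty_subset {s(u, v)})) := by
  refine ⟨rfl, rfl, rfl, ⟨s(u, v), ⟨0, by omega⟩, ?_, ?_, fun j hj => ?_⟩, fun _ _ => rfl⟩
  · exact Finset.empty_subset _
  · exact Finset.sdiff_empty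
  · have : j.val ≠ 0 := fun h => hj (Fin.ext h)
    simp [twoPaths, twoPathsData, this]

theorem two_mul_sub_two_mem_diffMstDistances (V : Type u) [DecidableEq V] [Infinite V] (W T : ℕ)
    (hW : 1 ≤ W) (hT : 2 ≤ T) : 2 * (W : ℝ) - 2 ∈ diffMstDistances V W T := by
  obtain ⟨u, v, x, y, hd⟩ : ∃ u v x y : V, [u, v, x, y].Nodup := by
    have g := Infinite.natEmbedding V
    exact ⟨g 0, g 1, g 2, g 3, by simp⟩
  have hadj := edgeAdj_twoPaths hd hW hT
  have hcon := allConnected_twoPaths hd hW hT (Finset.empty_subset {s(u, v)})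
  refine ⟨_, _, allConnected_twoPaths hd hW hT subset_rfl, hcon, hadj, ?_⟩
  obtain ⟨e, i, h, hsd⟩ := hadj.insertsAlso
  have hi : i = ⟨0, by omega⟩ := by
    by_contra hne
    have h0 : i.val ≠ 0 := fun h => hne (Fin.ext h)
    simp [twoPaths, twoPathsData, h0] at hsd
  subst hi
  have he : e = s(u, v) := by
    have : ({s(u, v)} : Finset (Sym2 V)) = {e} := by simpa [twoPaths, twoPathsData] using hsd
    exact (Finset.singleton_injective this).symm
  subst he
  set S := twoPaths hd hW hT (subset_refl {s(u, v)}) with hS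
  set S' := twoPaths hd hW hT (Finset.empty_subset {s(u, v)}) with hS'
  simp only [List.nodup_cons, List.mem_cons, List.not_mem_nil, or_false, not_or] at hd
  have hwe : S.weight s(u, v) = 1 := by
    refine if_neg ?_
    rw [Sym2.eq_iff]
    tauto
  have hw : ∀ f, S.weight f = if f = s(x, v) then W else 1 := fun _ => rfl
  have hE : ∀ t f, f ∈ S'.edges t ↔ f = s(u, x) ∨ f = s(x, v) ∨ f = s(u, y) ∨
      (1 ≤ t ∧ f ∈ (∅ : Finset (Sym2 V))) ∨ (2 ≤ t ∧ f = s(y, v)) :=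
    fun t f => mem_edges_twoPathsData hT
  -- At time 1 the only edge of `S'` at `v` is `xv`, of weight `W`, so `v` is isolated at all
  -- thresholds `1 ≤ k < W`.
  have hone : InsertsAlso.cyclePart S S' s(u, v) ⟨0, by omega⟩ 1 = W - 1 := by
    obtain ⟨n, rfl⟩ : ∃ n, W = n + 1 := ⟨W - 1, by omega⟩
    rw [InsertsAlso.cyclePart, if_pos Nat.one_pos, Finset.sum_range_succ', hwe,
      if_neg (by omega), add_zero]
    have : ∀ k ∈ Finset.range n, (if 1 ≤ k + 1 then
        joinInd (edgesLE (S'.edges 1) S.weight (k + 1)) s(u, v) else 0) = 1 := by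
      intro k hk
      have hkn := Finset.mem_range.1 hk
      rw [if_pos (by omega), joinInd, if_neg]
      rw [edgeVec_mem_edgeSpan_iff, SimpleGraph.reachable_comm]
      rintro ⟨p⟩
      cases p with
      | nil => exact hd.1.1 rfl
      | @cons _ z _ hadj _ =>
        obtain ⟨hmem, hne⟩ := (SimpleGraph.fromEdgeSet_adj _).1 hadj
        rw [Finset.mem_coe, edgesLE, Finset.mem_filter, hE, hw] at hmem
        obtain ⟨hmem, hle⟩ := hmem
        rcases hmem with h | h | h | ⟨-, h⟩ | ⟨h, -⟩
        · rw [Sym2.eq_iff] at h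
          have : ¬ v = u := fun h => hd.1.1 h.symm
          tauto
        · rw [if_pos h] at hle
          omega
        · rw [Sym2.eq_iff] at h
          have : ¬ v = u := fun h => hd.1.1 h.symm
          tauto
        · simp at h
        · omega
    rw [Finset.sum_congr rfl this]
    simp
  -- At time 2 the path `u y v` of weight-1 edges makes `uv` redundant.
  have htwo : InsertsAlso.cyclePart S S' s(u, v) ⟨0, by omega⟩ 2 = 0 := by
    rw [InsertsAlso.cyclePart, if_pos Nat.two_pos, hwe]
    refine Finset.sum_eq_zero fun k _ => ?_
    split_ifs with hk
    · rw [joinInd, if_pos]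
      rw [← edgeVec_add u y v]
      refine Submodule.add_mem _ (edgeVec_mem_edgeSpan ?_) (edgeVec_mem_edgeSpan ?_)
      · rw [Finset.mem_coe, edgesLE, Finset.mem_filter, hE, hw, if_neg]
        · tauto
        · rw [Sym2.eq_iff]
          tauto
      · rw [Finset.mem_coe, edgesLE, Finset.mem_filter, hE, hw, if_neg]
        · simp [hk]
        · rw [Sym2.eq_iff]
          have : ¬ y = x := fun h => hd.2.2.1 h.symm
          have : ¬ y = v := fun h => hd.2.1.2 h.symm
          tauto
    · rfl
  -- The difference of the weights is `0, -(W - 1), 0` at times 0, 1, 2, so the first two entries of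
  -- the sum already give `2W - 2`.
  refine le_antisymm (h.sum_diffMst_le hW hcon) ?_
  have e0 := h.mst_sub_of_connected hcon 0
  have e1 := h.mst_sub_of_connected hcon 1
  have e2 := h.mst_sub_of_connected hcon 2
  rw [InsertsAlso.cyclePart, if_neg (by simp)] at e0
  rw [hone] at e1
  rw [htwo] at e2
  have hW' : (1 : ℝ) ≤ W := by exact_mod_cast hW
  have hsub : ({⟨0, by omega⟩, ⟨1, by omega⟩} : Finset (Fin T)) ⊆ Finset.univ :=
    Finset.subset_univ _
  refine le_trans ?_ (Finset.sum_le_sum_of_subset_of_nonneg hsub fun _ _ _ => abs_nonneg _)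
  rw [Finset.sum_pair (by simp)]
  simp only [diffMst, zero_add, Nat.reduceAdd]
  have l1 := neg_le_abs ((S.mst 1 : ℝ) - S.mst 0 - (S'.mst 1 - S'.mst 0))
  have l2 := le_abs_self ((S.mst 2 : ℝ) - S.mst 1 - (S'.mst 2 - S'.mst 1))
  linarith

end IncrementalSeq

/-! ### Laplace noise -/

/-- The density of the Laplace distribution of scale `b`. -/
noncomputable def laplacePDF (b z : ℝ) : ℝ := Real.exp (-|z| / b) / (2 * b)

theorem continuous_laplacePDF (b : ℝ) : Continuous (laplacePDF b) := by
  unfold laplacePDF; fun_prop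

theorem laplacePDF_nonneg {b : ℝ} (hb : 0 < b) (z : ℝ) : 0 ≤ laplacePDF b z := by
  unfold laplacePDF; positivity

theorem laplacePDF_sub_le {b : ℝ} (hb : 0 < b) (x y z : ℝ) :
    laplacePDF b (z - x) ≤ Real.exp (|x - y| / b) * laplacePDF b (z - y) := by
  unfold laplacePDF
  rw [← mul_div_assoc, ← Real.exp_add]
  gcongr
  rw [← add_div]
  gcongr
  have h := abs_add_le (z - x) (x - y)
  rw [sub_add_sub_cancel] at h
  linarith

/-- The moment generating function, finite for `|c| < 1 / b`. Taking `c = 0` gives total mass 1;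
other `c` serve the Chernoff bound. -/
theorem laplacePDF_mul_exp_integral {b c : ℝ} (hb : 0 < b) (hc : |c| * b < 1) :
    Integrable (fun z => laplacePDF b z * Real.exp (c * z)) ∧
      ∫ z, laplacePDF b z * Real.exp (c * z) = 1 / (1 - c ^ 2 * b ^ 2) := by
  have hbi : b⁻¹ * b = 1 := inv_mul_cancel₀ hb.ne'
  have hc' : |c| < b⁻¹ := by rw [← one_div]; exact (lt_div_iff₀ hb).2 hc
  have hneg : c - b⁻¹ < 0 := by linarith [le_abs_self c]
  have hpos : 0 < c + b⁻¹ := by linarith [neg_abs_le c]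
  have hIoi : Set.EqOn (fun z => laplacePDF b z * Real.exp (c * z))
      (fun z => (2 * b)⁻¹ * Real.exp ((c - b⁻¹) * z)) (Set.Ioi 0) := by
    intro z hz
    simp only [laplacePDF]
    rw [abs_of_pos hz, div_mul_eq_mul_div, ← Real.exp_add, div_eq_inv_mul]
    congr 2
    field_simp
    ring
  have hIic : Set.EqOn (fun z => laplacePDF b z * Real.exp (c * z))
      (fun z => (2 * b)⁻¹ * Real.exp ((c + b⁻¹) * z)) (Set.Iic 0) := by
    intro z hz
    simp only [laplacePDF]
    rw [abs_of_nonpos hz, div_mul_eq_mul_div, ← Real.exp_add, div_eq_inv_mul]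
    congr 2
    field_simp
    ring
  have i1 : IntegrableOn (fun z => laplacePDF b z * Real.exp (c * z)) (Set.Ioi 0) :=
    (integrableOn_congr_fun hIoi measurableSet_Ioi).2
      ((integrableOn_exp_mul_Ioi hneg 0).const_mul _)
  have i2 : IntegrableOn (fun z => laplacePDF b z * Real.exp (c * z)) (Set.Iic 0) :=
    (integrableOn_congr_fun hIic measurableSet_Iic).2
      ((integrableOn_exp_mul_Iic hpos 0).const_mul _)
  refine ⟨by rw [← integrableOn_univ, ← Set.Iic_union_Ioi (a := (0 : ℝ))]; exact i2.union i1, ?_⟩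
  rw [← intervalIntegral.integral_Iic_add_Ioi i2 i1, setIntegral_congr_fun measurableSet_Iic hIic,
    setIntegral_congr_fun measurableSet_Ioi hIoi, integral_const_mul, integral_const_mul,
    integral_exp_mul_Iic hpos, integral_exp_mul_Ioi hneg]
  simp only [mul_zero, Real.exp_zero]
  have h1 : c * b - 1 < 0 := by
    have := mul_lt_mul_of_pos_right (le_abs_self c |>.trans_lt hc') hb
    linarith
  have h2 : 0 < c * b + 1 := by
    have := mul_pos hpos hb
    linarith [add_mul c b⁻¹ b]
  have e1 : c - b⁻¹ = (c * b - 1) / b := by field_simp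
  have e2 : c + b⁻¹ = (c * b + 1) / b := by field_simp
  have e3 : 1 - c ^ 2 * b ^ 2 = -((c * b - 1) * (c * b + 1)) := by ring
  rw [e1, e2, e3]
  clear e1 e2 e3
  generalize c * b = x at h1 h2 ⊢
  have := h1.ne
  have := h2.ne'
  field_simp
  ring

/-- The law of a vector of independent Laplace variables of scale `b`. -/
noncomputable def laplaceVec (ι : Type*) [Fintype ι] (b : ℝ) : Measure (ι → ℝ) :=
  volume.withDensity fun z => ENNReal.ofReal (∏ i, laplacePDF b (z i))

section

variable {ι : Type*} [Fintype ι] {b : ℝ}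

theorem measurable_laplaceVec_density (b : ℝ) :
    Measurable fun z : ι → ℝ => ENNReal.ofReal (∏ i, laplacePDF b (z i)) := by
  refine ENNReal.measurable_ofReal.comp (Finset.measurable_prod _ fun i _ => ?_)
  exact (continuous_laplacePDF b).measurable.comp (measurable_pi_apply i)

theorem lintegral_exp_laplaceVec (hb : 0 < b) {c : ι → ℝ} (hc : ∀ i, |c i| * b < 1) :
    ∫⁻ z, ENNReal.ofReal (Real.exp (∑ i, c i * z i)) ∂laplaceVec ι b =
      ENNReal.ofReal (∏ i, 1 / (1 - c i ^ 2 * b ^ 2)) := by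
  rw [laplaceVec, lintegral_withDensity_eq_lintegral_mul _ (measurable_laplaceVec_density b)
    (by fun_prop)]
  have h : ∀ z : ι → ℝ, ((fun z : ι → ℝ => ENNReal.ofReal (∏ i, laplacePDF b (z i))) *
      fun z : ι → ℝ => ENNReal.ofReal (Real.exp (∑ i, c i * z i))) z =
        ENNReal.ofReal (∏ i, laplacePDF b (z i) * Real.exp (c i * z i)) := by
    intro z
    rw [Pi.mul_apply, ← ENNReal.ofReal_mul (Finset.prod_nonneg fun i _ => laplacePDF_nonneg hb _),
      Real.exp_sum, Finset.prod_mul_distrib]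
  simp_rw [h]
  rw [← ofReal_integral_eq_lintegral_ofReal, integral_fintype_prod_volume_eq_prod
    (fun i z => laplacePDF b z * Real.exp (c i * z))]
  · congr 1
    exact Finset.prod_congr rfl fun i _ => (laplacePDF_mul_exp_integral hb (hc i)).2
  · exact Integrable.fintype_prod (f := fun i z => laplacePDF b z * Real.exp (c i * z))
      fun i => (laplacePDF_mul_exp_integral hb (hc i)).1
  · exact Filter.Eventually.of_forall fun z => Finset.prod_nonneg fun i _ =>
      mul_nonneg (laplacePDF_nonneg hb _) (Real.exp_nonneg _)

theorem isProbabilityMeasure_laplaceVec (hb : 0 < b) :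
    IsProbabilityMeasure (laplaceVec ι b) := by
  have h := lintegral_exp_laplaceVec (ι := ι) hb (c := fun _ => 0) (by simp)
  simp only [zero_mul, Finset.sum_const_zero, Real.exp_zero, ENNReal.ofReal_one, lintegral_one] at h
  exact ⟨by simpa using h⟩

theorem map_add_laplaceVec (g : ι → ℝ) :
    (laplaceVec ι b).map (g + ·) =
      volume.withDensity fun x => ENNReal.ofReal (∏ i, laplacePDF b (x i - g i)) := by
  ext O hO
  have hm : Measurable (g + · : (ι → ℝ) → ι → ℝ) := measurable_const_add g
  rw [Measure.map_apply hm hO, laplaceVec, withDensity_apply _ (hm hO), withDensity_apply _ hO,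
    ← lintegral_indicator (hm hO), ← lintegral_indicator hO]
  refine Eq.trans ?_ (lintegral_add_left_eq_self _ g)
  refine lintegral_congr fun z => ?_
  simp only [Set.indicator, Set.mem_preimage, Pi.add_apply, add_sub_cancel_left]
  rfl

theorem map_add_laplaceVec_le (hb : 0 < b) (g g' : ι → ℝ) :
    (laplaceVec ι b).map (g + ·) ≤
      ENNReal.ofReal (Real.exp ((∑ i, |g i - g' i|) / b)) • (laplaceVec ι b).map (g' + ·) := by
  rw [map_add_laplaceVec, map_add_laplaceVec, ← withDensity_smul']
  · refine withDensity_mono (Filter.Eventually.of_forall fun x => ?_)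
    rw [Pi.smul_apply, smul_eq_mul, ← ENNReal.ofReal_mul (Real.exp_nonneg _)]
    refine ENNReal.ofReal_le_ofReal ?_
    rw [Finset.sum_div, Real.exp_sum, ← Finset.prod_mul_distrib]
    exact Finset.prod_le_prod (fun i _ => laplacePDF_nonneg hb _)
      fun i _ => laplacePDF_sub_le hb _ _ _
  · exact ENNReal.ofReal_ne_top

/-- With `n` the cardinality of `A`, the integral is `(1 - 1 / (4n))⁻ⁿ`, and Bernoulli's inequality
bounds the power below by `3 / 4`. -/
theorem lintegral_exp_sum_laplaceVec_le [DecidableEq ι] (hb : 0 < b) {A : Finset ι}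
    (hA : A.Nonempty) {r : ℝ} (hr : r ^ 2 * b ^ 2 * (4 * A.card) = 1) :
    ∫⁻ z, ENNReal.ofReal (Real.exp (r * ∑ i ∈ A, z i)) ∂laplaceVec ι b ≤
      ENNReal.ofReal (4 / 3) := by
  have hcard : (1 : ℝ) ≤ A.card := by exact_mod_cast hA.card_pos
  have hrb : r ^ 2 * b ^ 2 = 1 / (4 * A.card) := by rw [eq_div_iff (by positivity), hr]
  have hquarter : r ^ 2 * b ^ 2 ≤ 1 / 4 := by
    rw [hrb]
    exact one_div_le_one_div_of_le (by norm_num) (by linarith)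
  have hlt : |r| * b < 1 := by
    have h1 : (|r| * b) ^ 2 < 1 := by rw [mul_pow, sq_abs]; linarith
    nlinarith [mul_nonneg (abs_nonneg r) hb.le]
  have h := lintegral_exp_laplaceVec hb (c := fun i => if i ∈ A then r else 0) (by
    intro i
    split_ifs
    · exact hlt
    · simp)
  have hsum : ∀ z : ι → ℝ, ∑ i, (if i ∈ A then r else 0) * z i = r * ∑ i ∈ A, z i := by
    intro z
    simp [ite_mul, Finset.sum_ite_mem, Finset.mul_sum]
  simp_rw [hsum] at h
  rw [h]
  refine ENNReal.ofReal_le_ofReal ?_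
  have hprod : ∏ i, 1 / (1 - (if i ∈ A then r else 0) ^ 2 * b ^ 2) =
      (1 / (1 - r ^ 2 * b ^ 2)) ^ A.card := by
    rw [← Finset.prod_const, ← Finset.prod_subset (Finset.subset_univ A)]
    · exact Finset.prod_congr rfl fun i hi => by rw [if_pos hi]
    · intro i _ hi
      simp [hi]
  rw [hprod, one_div_pow]
  have hbern := one_add_mul_le_pow (a := -(r ^ 2 * b ^ 2)) (by linarith) A.card
  have h34 : (3 : ℝ) / 4 ≤ (1 - r ^ 2 * b ^ 2) ^ A.card := by
    have : (A.card : ℝ) * (r ^ 2 * b ^ 2) = 1 / 4 := by linarith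
    calc (3 : ℝ) / 4 = 1 + A.card * -(r ^ 2 * b ^ 2) := by linarith
      _ ≤ _ := by rwa [sub_eq_add_neg]
  calc 1 / (1 - r ^ 2 * b ^ 2) ^ A.card ≤ 1 / (3 / 4) :=
        one_div_le_one_div_of_le (by norm_num) h34
    _ = 4 / 3 := by norm_num

/-- Chernoff's bound with exponent `r = 1 / (2 b √|A|)`, applied to both signs, whence `8 / 3 = 2 ·
4 / 3`. -/
theorem laplaceVec_abs_sum_gt_le [DecidableEq ι] (hb : 0 < b) {A : Finset ι} (hA : A.Nonempty)
    (s : ℝ) :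
    laplaceVec ι b {z | s < |∑ i ∈ A, z i|} ≤
      ENNReal.ofReal (8 / 3 * Real.exp (-(s / (2 * (b * Real.sqrt A.card))))) := by
  have hcard : (0 : ℝ) < A.card := by exact_mod_cast hA.card_pos
  have hsq := Real.sq_sqrt hcard.le
  have hsqrt : 0 < Real.sqrt A.card := Real.sqrt_pos.2 hcard
  set r : ℝ := 1 / (2 * (b * Real.sqrt A.card)) with hr
  have hrpos : 0 < r := by positivity
  have hr1 : r ^ 2 * b ^ 2 * (4 * A.card) = 1 := by
    rw [← hsq, hr]
    field_simp
    ring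
  have hle : ∫⁻ z, (ENNReal.ofReal (Real.exp (r * ∑ i ∈ A, z i)) +
      ENNReal.ofReal (Real.exp (-r * ∑ i ∈ A, z i))) ∂laplaceVec ι b ≤ ENNReal.ofReal (8 / 3) := by
    rw [lintegral_add_left (by fun_prop)]
    refine (add_le_add (lintegral_exp_sum_laplaceVec_le hb hA hr1)
      (lintegral_exp_sum_laplaceVec_le hb hA (by rw [neg_sq]; exact hr1))).trans ?_
    rw [← ENNReal.ofReal_add (by norm_num) (by norm_num)]
    norm_num
  have hmarkov := mul_meas_ge_le_lintegral₀ (μ := laplaceVec ι b)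
    (f := fun z => ENNReal.ofReal (Real.exp (r * ∑ i ∈ A, z i)) +
      ENNReal.ofReal (Real.exp (-r * ∑ i ∈ A, z i))) (by fun_prop) (ENNReal.ofReal (Real.exp (r * s)))
  have hsub : {z : ι → ℝ | s < |∑ i ∈ A, z i|} ⊆ {z | ENNReal.ofReal (Real.exp (r * s)) ≤
      ENNReal.ofReal (Real.exp (r * ∑ i ∈ A, z i)) +
        ENNReal.ofReal (Real.exp (-r * ∑ i ∈ A, z i))} := by
    intro z hz
    simp only [Set.mem_ofPred_eq] at hz ⊢
    rcases abs_cases (∑ i ∈ A, z i) with ⟨h, -⟩ | ⟨h, -⟩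
    · refine le_trans (ENNReal.ofReal_le_ofReal (Real.exp_le_exp.2 ?_)) le_self_add
      exact mul_le_mul_of_nonneg_left (by linarith) hrpos.le
    · refine le_trans (ENNReal.ofReal_le_ofReal (Real.exp_le_exp.2 ?_)) le_add_self
      rw [neg_mul, ← mul_neg]
      exact mul_le_mul_of_nonneg_left (by linarith) hrpos.le
  have hfin : ENNReal.ofReal (Real.exp (r * s)) * laplaceVec ι b {z | s < |∑ i ∈ A, z i|} ≤
      ENNReal.ofReal (8 / 3) :=
    (mul_le_mul_right (measure_mono hsub) _).trans (hmarkov.trans hle)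
  have hexp : (8 / 3 : ℝ) * Real.exp (-(s / (2 * (b * Real.sqrt A.card)))) =
      (8 / 3) / Real.exp (r * s) := by
    rw [div_eq_mul_inv _ (Real.exp _), ← Real.exp_neg, hr]
    congr 3
    ring
  rw [hexp, ENNReal.ofReal_div_of_pos (Real.exp_pos _), ENNReal.le_div_iff_mul_le, mul_comm]
  · exact hfin
  · exact Or.inl (by simp [Real.exp_pos])
  · exact Or.inl ENNReal.ofReal_ne_top

end

/-- Privacy survives post-processing with independent additional randomness. -/
theorem map_prod_le_of_le_smul {α β γ : Type*} [MeasurableSpace α] [MeasurableSpace β]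
    [MeasurableSpace γ] {μ₁ μ₂ : Measure α} {c : ENNReal} (h : μ₁ ≤ c • μ₂) (ν : Measure β)
    [SFinite ν] {Φ : α × β → γ} (hΦ : Measurable Φ) {O : Set γ} (hO : MeasurableSet O) :
    (μ₁.prod ν).map Φ O ≤ c * (μ₂.prod ν).map Φ O := by
  rw [Measure.map_apply hΦ hO, Measure.map_apply hΦ hO, Measure.prod_apply (hΦ hO),
    Measure.prod_apply (hΦ hO)]
  refine (lintegral_mono' h le_rfl).trans ?_
  rw [lintegral_smul_measure, smul_eq_mul]

/-! ### The uniform shift and accuracy for every `δ` -/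

/-- The uniform distribution on `[-K, K]`. -/
noncomputable def uniformSym (K : ℝ) : Measure ℝ :=
  ProbabilityTheory.cond volume (Set.Icc (-K) K)

theorem isProbabilityMeasure_uniformSym {K : ℝ} (hK : 0 < K) :
    IsProbabilityMeasure (uniformSym K) := by
  refine ProbabilityTheory.cond_isProbabilityMeasure_of_finite ?_ ?_
  · rw [Real.volume_Icc, ne_eq, ENNReal.ofReal_eq_zero]
    linarith
  · rw [Real.volume_Icc]
    exact ENNReal.ofReal_ne_top

theorem uniformSym_Icc {K : ℝ} (hK : 0 < K) : uniformSym K (Set.Icc (-K) K) = 1 := by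
  refine ProbabilityTheory.cond_apply_self ?_ ?_
  · rw [Real.volume_Icc, ne_eq, ENNReal.ofReal_eq_zero]
    linarith
  · rw [Real.volume_Icc]
    exact ENNReal.ofReal_ne_top

theorem le_uniformSym_abs_add_le {K x s : ℝ} (hK : 0 < K) (hx : |x| + s ≤ K) :
    ENNReal.ofReal (s / K) ≤ uniformSym K {u | |x + u| ≤ s} := by
  rw [uniformSym, ProbabilityTheory.cond_apply measurableSet_Icc, Real.volume_Icc]
  have hsub : Set.Icc (-x - s) (-x + s) ⊆ Set.Icc (-K) K ∩ {u | |x + u| ≤ s} := by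
    intro u hu
    have h1 := neg_abs_le x
    have h2 := le_abs_self x
    have h3 := hu.1
    have h4 := hu.2
    have habs : |x + u| ≤ s := abs_le.2 ⟨by linarith, by linarith⟩
    exact ⟨⟨by linarith, by linarith⟩, habs⟩
  refine le_trans (le_of_eq ?_) (mul_le_mul_right (measure_mono hsub) _)
  rw [Real.volume_Icc, ← ENNReal.ofReal_inv_of_pos (by linarith), ← ENNReal.ofReal_mul
    (inv_nonneg.2 (by linarith))]
  congr 1
  field_simp
  ring

theorem le_measure_compl_of_le {α : Type*} [MeasurableSpace α] {μ : Measure α}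
    [IsProbabilityMeasure μ] {s : Set α} (hs : MeasurableSet s) {δ : ℝ} (hδ : 0 ≤ δ)
    (h : μ s ≤ ENNReal.ofReal δ) : ENNReal.ofReal (1 - δ) ≤ μ sᶜ := by
  rw [prob_compl_eq_one_sub hs, ENNReal.ofReal_sub _ hδ, ENNReal.ofReal_one]
  exact tsub_le_tsub_left h 1

/-- For small `δ` the Laplace tail decides and the shift is a bounded extra error. For `δ` near 1
the allowed error is only of order `σ (1 - δ)`, and the shift hits such a short interval with
proportional probability. -/
theorem le_prod_abs_sum_add_le {ι : Type*} [Fintype ι] [DecidableEq ι] {b : ℝ} (hb : 0 < b)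
    {A : Finset ι} (hA : A.Nonempty) {σ : ℝ} (hσ : σ = b * Real.sqrt A.card) {δ : ℝ} (hδ : 0 < δ)
    (hδ1 : δ < 1) :
    ENNReal.ofReal (1 - δ) ≤ ((laplaceVec ι b).prod (uniformSym (8 * σ)))
      {p | |∑ i ∈ A, p.1 i + p.2| ≤ 42 * σ * Real.log δ⁻¹} := by
  have hcard : (0 : ℝ) < A.card := by exact_mod_cast hA.card_pos
  have hσpos : 0 < σ := by rw [hσ]; exact mul_pos hb (Real.sqrt_pos.2 hcard)
  have hK : 0 < 8 * σ := by linarith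
  have := isProbabilityMeasure_laplaceVec (ι := ι) hb
  have := isProbabilityMeasure_uniformSym hK
  have hlog : 1 - δ ≤ Real.log δ⁻¹ := by
    have := Real.one_sub_inv_le_log_of_pos (inv_pos.2 hδ)
    rwa [inv_inv] at this
  have htail := fun s => laplaceVec_abs_sum_gt_le hb hA s
  rw [← hσ] at htail
  have hmeas : ∀ s : ℝ, MeasurableSet {z : ι → ℝ | s < |∑ i ∈ A, z i|} := fun s =>
    measurableSet_lt measurable_const (by fun_prop)
  rcases le_or_gt δ (3 / 4) with hcase | hcase
  -- Here `l ≥ 1 / 4`, so the shift costs at most `8σ ≤ 32σl`, and `42 = 10 + 32`. The tail at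
  -- `10σl` is `8 / 3 · δ⁵ ≤ δ`.
  · set l := Real.log δ⁻¹ with hl
    have hexp : Real.exp (-(10 * σ * l / (2 * σ))) = δ ^ 5 := by
      have h1 : -(10 * σ * l / (2 * σ)) = (5 : ℕ) * Real.log δ := by
        rw [hl, Real.log_inv]
        push_cast
        field_simp
        ring
      rw [h1, ← Real.log_pow, Real.exp_log (by positivity)]
    have hbad : laplaceVec ι b {z | 10 * σ * l < |∑ i ∈ A, z i|} ≤ ENNReal.ofReal δ := by
      refine (htail _).trans (ENNReal.ofReal_le_ofReal ?_)
      rw [hexp]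
      have h4 : δ ^ 4 ≤ (3 / 4) ^ 4 := pow_le_pow_left₀ hδ.le hcase 4
      have h5 : δ ^ 5 = δ ^ 4 * δ := by ring
      rw [h5]
      nlinarith
    have hgood := le_measure_compl_of_le (hmeas _) hδ.le hbad
    have hsub : {z : ι → ℝ | 10 * σ * l < |∑ i ∈ A, z i|}ᶜ ×ˢ Set.Icc (-(8 * σ)) (8 * σ) ⊆
        {p : (ι → ℝ) × ℝ | |∑ i ∈ A, p.1 i + p.2| ≤ 42 * σ * l} := by
      rintro ⟨z, u⟩ ⟨hz, hu⟩
      have hz' : |∑ i ∈ A, z i| ≤ 10 * σ * l := not_lt.1 hz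
      have hu' : |u| ≤ 8 * σ := abs_le.2 hu
      have hle : 8 * σ ≤ 32 * σ * l := by nlinarith
      have habs : |∑ i ∈ A, z i + u| ≤ 42 * σ * l := by
        have := abs_add_le (∑ i ∈ A, z i) u
        linarith
      exact habs
    refine le_trans ?_ (measure_mono hsub)
    rw [Measure.prod_prod, uniformSym_Icc hK, mul_one]
    exact hgood
  -- Now `s ≤ 4σ`. With probability at least `1 / 2` the Laplace sum is at most `4σ` in absolute
  -- value, and then the shift brings it within `s` with probability at least `s / (8σ)`; the
  -- product is exactly `1 - δ`.
  · set s := 16 * σ * (1 - δ) with hs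
    have hs0 : 0 ≤ s := mul_nonneg (mul_nonneg (by norm_num) hσpos.le) (sub_nonneg.2 hδ1.le)
    have hmeasS : MeasurableSet {p : (ι → ℝ) × ℝ | |∑ i ∈ A, p.1 i + p.2| ≤ s} :=
      measurableSet_le (by fun_prop) measurable_const
    have hsub : {p : (ι → ℝ) × ℝ | |∑ i ∈ A, p.1 i + p.2| ≤ s} ⊆
        {p | |∑ i ∈ A, p.1 i + p.2| ≤ 42 * σ * Real.log δ⁻¹} := by
      intro p hp
      have h1 : |∑ i ∈ A, p.1 i + p.2| ≤ s := hp
      have h2 : s ≤ 42 * σ * Real.log δ⁻¹ := by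
        have := mul_le_mul_of_nonneg_left hlog hσpos.le
        have h0 : 0 ≤ σ * (1 - δ) := mul_nonneg hσpos.le (by linarith)
        rw [hs]
        nlinarith
      exact h1.trans h2
    refine le_trans ?_ (measure_mono hsub)
    have hhalf : ENNReal.ofReal (1 / 2) ≤ laplaceVec ι b {z | 4 * σ < |∑ i ∈ A, z i|}ᶜ := by
      have hbad : laplaceVec ι b {z | 4 * σ < |∑ i ∈ A, z i|} ≤ ENNReal.ofReal (1 / 2) := by
        refine (htail _).trans (ENNReal.ofReal_le_ofReal ?_)
        have h1 : 4 * σ / (2 * σ) = 2 := by field_simp; norm_num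
        rw [h1, Real.exp_neg]
        have h2 : (16 : ℝ) / 3 ≤ Real.exp 2 := by
          have h3 := Real.exp_one_gt_d9
          have h4 : Real.exp 2 = Real.exp 1 * Real.exp 1 := by rw [← Real.exp_add]; norm_num
          rw [h4]
          nlinarith
        rw [← div_eq_mul_inv, div_le_iff₀ (Real.exp_pos _)]
        linarith
      have := le_measure_compl_of_le (hmeas _) (by norm_num) hbad
      norm_num at this ⊢
      exact this
    rw [Measure.prod_apply hmeasS]
    calc ENNReal.ofReal (1 - δ) = ENNReal.ofReal (s / (8 * σ)) * ENNReal.ofReal (1 / 2) := by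
          rw [← ENNReal.ofReal_mul (div_nonneg hs0 hK.le)]
          congr 1
          rw [hs]
          field_simp
          ring
      _ ≤ ENNReal.ofReal (s / (8 * σ)) * laplaceVec ι b {z | 4 * σ < |∑ i ∈ A, z i|}ᶜ :=
          mul_le_mul_right hhalf _
      _ = ∫⁻ _ in {z | 4 * σ < |∑ i ∈ A, z i|}ᶜ, ENNReal.ofReal (s / (8 * σ)) ∂laplaceVec ι b := by
          rw [setLIntegral_const]
      _ ≤ ∫⁻ z in {z | 4 * σ < |∑ i ∈ A, z i|}ᶜ, uniformSym (8 * σ)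
            (Prod.mk z ⁻¹' {p : (ι → ℝ) × ℝ | |∑ i ∈ A, p.1 i + p.2| ≤ s}) ∂laplaceVec ι b := by
          refine setLIntegral_mono' (hmeas _).compl fun z hz => ?_
          have hz' : |∑ i ∈ A, z i| ≤ 4 * σ := not_lt.1 hz
          have hsum : |∑ i ∈ A, z i| + s ≤ 8 * σ := by
            rw [hs]
            nlinarith
          exact le_uniformSym_abs_add_le hK hsum
      _ ≤ _ := setLIntegral_le_lintegral _ _

/-! ### The dyadic tree -/

/-- The increment of `f` over the dyadic interval that ends at `q * 2 ^ l` and has length `2 ^ l`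
if `q` is odd; zero if `q` is even. -/
def dyadicIncr (f : ℕ → ℝ) (l q : ℕ) : ℝ := f (q * 2 ^ l) - f (q / 2 * 2 ^ (l + 1))

/-- Each term is the increment between `t` with its lowest `l + 1` bits cleared and `t` with its
lowest `l` bits cleared; the sum telescopes. -/
theorem sum_dyadicIncr (f : ℕ → ℝ) {t L : ℕ} (ht : t < 2 ^ L) :
    ∑ l ∈ Finset.range L, dyadicIncr f l (t / 2 ^ l) = f t - f 0 := by
  have h : ∀ l, dyadicIncr f l (t / 2 ^ l) =
      f (t / 2 ^ l * 2 ^ l) - f (t / 2 ^ (l + 1) * 2 ^ (l + 1)) := by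
    intro l
    rw [dyadicIncr, Nat.div_div_eq_div_mul, ← pow_succ]
  simp_rw [h]
  rw [Finset.sum_range_sub' fun l => f (t / 2 ^ l * 2 ^ l)]
  simp [Nat.div_eq_of_lt ht]

theorem abs_dyadicIncr_le (f : ℕ → ℝ) (l q : ℕ) :
    |dyadicIncr f l (q + 1)| ≤ |f ((q + 1) * 2 ^ l) - f (q * 2 ^ l)| := by
  rcases Nat.even_or_odd' q with ⟨m, rfl | rfl⟩
  · have h : (2 * m + 1) / 2 * 2 ^ (l + 1) = 2 * m * 2 ^ l := by
      rw [show (2 * m + 1) / 2 = m by omega]; ring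
    rw [dyadicIncr, h]
  · have h : (2 * m + 1 + 1) / 2 * 2 ^ (l + 1) = (2 * m + 1 + 1) * 2 ^ l := by
      rw [show (2 * m + 1 + 1) / 2 = m + 1 by omega]; ring
    rw [dyadicIncr, h, sub_self, abs_zero]
    exact abs_nonneg _

theorem sum_abs_dyadicIncr_le (f : ℕ → ℝ) (l T : ℕ) :
    ∑ q ∈ Finset.range (T + 1), |dyadicIncr f l q| ≤
      ∑ q ∈ Finset.range T, |f ((q + 1) * 2 ^ l) - f (q * 2 ^ l)| := by
  rw [Finset.sum_range_succ']
  have h0 : dyadicIncr f l 0 = 0 := by simp [dyadicIncr]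
  rw [h0, abs_zero, add_zero]
  exact Finset.sum_le_sum fun q _ => abs_dyadicIncr_le f l q

/-- The number of levels of the dyadic tree over `T` time steps. -/
def treeDepth (T : ℕ) : ℕ := Nat.log 2 T + 1

/-- The nodes of the dyadic tree over `T` time steps. -/
abbrev TreeNode (T : ℕ) : Type := Fin (treeDepth T) × Fin (T + 1)

/-- The dyadic increments of `f`. -/
def treeVec (T : ℕ) (f : ℕ → ℝ) (p : TreeNode T) : ℝ := dyadicIncr f p.1 p.2

/-- The node on level `l` that contributes to the output with index `i`. -/
def treeNode {T : ℕ} (i : Fin T) (l : Fin (treeDepth T)) : TreeNode T :=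
  (l, ⟨(i.val + 1) / 2 ^ l.val, by
    have := Nat.div_le_self (i.val + 1) (2 ^ l.val)
    have := i.isLt
    omega⟩)

theorem treeNode_injective {T : ℕ} (i : Fin T) : Function.Injective (treeNode i) :=
  fun _ _ h => congrArg Prod.fst h

/-- The nodes that contribute to the output with index `i`. -/
def treePath {T : ℕ} (i : Fin T) : Finset (TreeNode T) :=
  Finset.univ.image (treeNode i)

/-- Every level counts, even where the increment vanishes, so all outputs carry equally many noise
terms. -/
theorem card_treePath {T : ℕ} (i : Fin T) : (treePath i).card = treeDepth T := by
  rw [treePath, Finset.card_image_of_injective _ (treeNode_injective i), Finset.card_univ,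
    Fintype.card_fin]

theorem sum_treeVec {T : ℕ} (f : ℕ → ℝ) (i : Fin T) :
    ∑ p ∈ treePath i, treeVec T f p = f (i.val + 1) - f 0 := by
  rw [treePath, Finset.sum_image fun _ _ _ _ h => treeNode_injective i h]
  have hlt : i.val + 1 < 2 ^ treeDepth T :=
    lt_of_le_of_lt i.isLt (Nat.lt_pow_succ_log_self (by norm_num) T)
  rw [← sum_dyadicIncr f hlt, Finset.sum_range]
  rfl

theorem sum_abs_treeVec_sub_le {T : ℕ} {f g : ℕ → ℝ} {M : ℝ}
    (h : ∀ l : ℕ, ∑ q ∈ Finset.range T, |(f ((q + 1) * 2 ^ l) - f (q * 2 ^ l)) -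
      (g ((q + 1) * 2 ^ l) - g (q * 2 ^ l))| ≤ M) :
    ∑ p, |treeVec T f p - treeVec T g p| ≤ treeDepth T * M := by
  rw [Fintype.sum_prod_type]
  calc _ ≤ ∑ l : Fin (treeDepth T), M := Finset.sum_le_sum fun l _ => ?_
    _ = _ := by simp
  refine le_trans (le_of_eq ?_) ((sum_abs_dyadicIncr_le (fun t => f t - g t) l T).trans
    (le_trans (le_of_eq ?_) (h l)))
  · rw [Finset.sum_range]
    refine Finset.sum_congr rfl fun q _ => ?_
    congr 1
    simp only [treeVec, dyadicIncr]
    ring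
  · refine Finset.sum_congr rfl fun q _ => ?_
    congr 1
    ring

/-- The noisy prefix sums: the output with index `i` is `f (i + 1)`, perturbed by the noise of the
tree nodes that contribute to it and by a common shift. -/
def treeRelease (T : ℕ) (f : ℕ → ℝ) (p : (TreeNode T → ℝ) × ℝ) (i : Fin T) : ℝ :=
  f (i.val + 1) + (∑ n ∈ treePath i, p.1 n + p.2)

theorem measurable_treeRelease (T : ℕ) (f : ℕ → ℝ) : Measurable (treeRelease T f) := by
  unfold treeRelease
  fun_prop

/-- The joint law of the noise: Laplace noise of scale `b` at the tree nodes and a shift that is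
uniform on `[-K, K]`. -/
noncomputable def treeNoise (T : ℕ) (b K : ℝ) : Measure ((TreeNode T → ℝ) × ℝ) :=
  (laplaceVec (TreeNode T) b).prod (uniformSym K)

theorem map_treeRelease_le {T : ℕ} {b K M : ℝ} (hb : 0 < b) (hK : 0 < K) {f g : ℕ → ℝ}
    (h0 : f 0 = g 0)
    (h : ∀ l : ℕ, ∑ q ∈ Finset.range T, |(f ((q + 1) * 2 ^ l) - f (q * 2 ^ l)) -
      (g ((q + 1) * 2 ^ l) - g (q * 2 ^ l))| ≤ M)
    {O : Set (Fin T → ℝ)} (hO : MeasurableSet O) :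
    (treeNoise T b K).map (treeRelease T f) O ≤
      ENNReal.ofReal (Real.exp (treeDepth T * M / b)) *
        (treeNoise T b K).map (treeRelease T g) O := by
  have := isProbabilityMeasure_laplaceVec (ι := TreeNode T) hb
  have := isProbabilityMeasure_uniformSym hK
  let Φ : (TreeNode T → ℝ) × ℝ → Fin T → ℝ :=
    fun p i => f 0 + (∑ n ∈ treePath i, p.1 n + p.2)
  have hΦ : Measurable Φ := by fun_prop
  -- The release is a fixed map `Φ` of the noisy increments and the shift: increments along a path
  -- sum to `e (i + 1) - e 0`, and `e 0` is common to both sequences.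
  have key : ∀ e : ℕ → ℝ, e 0 = f 0 → (treeNoise T b K).map (treeRelease T e) =
      (((laplaceVec (TreeNode T) b).map (treeVec T e + ·)).prod (uniformSym K)).map Φ := by
    intro e he
    have hm : Measurable (treeVec T e + · : (TreeNode T → ℝ) → TreeNode T → ℝ) :=
      measurable_const_add _
    conv_rhs => rw [← Measure.map_id (μ := uniformSym K)]
    rw [Measure.map_prod_map _ _ hm measurable_id, Measure.map_map hΦ (hm.prodMap measurable_id),
      treeNoise]
    congr 1
    ext p i
    simp only [treeRelease, Φ, Function.comp, Prod.map, Pi.add_apply, Finset.sum_add_distrib,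
      sum_treeVec, id]
    rw [he]
    ring
  rw [key f rfl, key g h0.symm]
  refine (map_prod_le_of_le_smul (map_add_laplaceVec_le hb (treeVec T f) (treeVec T g)) _ hΦ
    hO).trans (mul_le_mul_left (ENNReal.ofReal_le_ofReal (Real.exp_le_exp.2 ?_)) _)
  gcongr
  exact sum_abs_treeVec_sub_le h

theorem treeDepth_le {T : ℕ} (hT : 2 ≤ T) : (treeDepth T : ℝ) ≤ 3 * Real.log T := by
  have hT' : (2 : ℝ) ≤ T := by exact_mod_cast hT
  have hlog2 := Real.log_two_gt_d9
  have h1 : (Nat.log 2 T : ℝ) * Real.log 2 ≤ Real.log T := by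
    rw [← Real.log_pow]
    refine Real.log_le_log (by positivity) ?_
    exact_mod_cast Nat.pow_log_le_self 2 (by omega)
  have h2 : Real.log 2 ≤ Real.log T := Real.log_le_log (by norm_num) hT'
  rw [treeDepth]
  push_cast
  nlinarith

theorem treeDepth_mul_sqrt_le {T : ℕ} (hT : 2 ≤ T) :
    (treeDepth T : ℝ) * Real.sqrt (treeDepth T) ≤ 6 * Real.log T ^ (3 / 2 : ℝ) := by
  have hT' : (2 : ℝ) ≤ T := by exact_mod_cast hT
  have hpos : 0 < Real.log T := Real.log_pos (by linarith)
  have h := treeDepth_le hT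
  have h1 : Real.log T ^ (3 / 2 : ℝ) = Real.log T * Real.sqrt (Real.log T) := by
    rw [show (3 / 2 : ℝ) = 1 + 1 / 2 by norm_num, Real.rpow_add hpos, Real.rpow_one,
      Real.sqrt_eq_rpow]
  have h2 : Real.sqrt 3 ≤ 2 := Real.sqrt_le_iff.2 ⟨by norm_num, by norm_num⟩
  have h3 : Real.sqrt (treeDepth T) ≤ 2 * Real.sqrt (Real.log T) := by
    refine (Real.sqrt_le_sqrt h).trans ?_
    rw [Real.sqrt_mul (by norm_num)]
    exact mul_le_mul_of_nonneg_right h2 (Real.sqrt_nonneg _)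
  rw [h1]
  calc (treeDepth T : ℝ) * Real.sqrt (treeDepth T)
      ≤ (3 * Real.log T) * (2 * Real.sqrt (Real.log T)) :=
        mul_le_mul h h3 (Real.sqrt_nonneg _) (by linarith)
    _ = _ := by ring

/-! ### The private algorithm for the minimum spanning tree weight -/

namespace IncrementalSeq

variable {V : Type u} [DecidableEq V] {W T : ℕ}

theorem AgreeUpTo.mst_eq {t : ℕ} {S S' : IncrementalSeq V W T} (h : S.AgreeUpTo t S') {s : ℕ}
    (hs : s ≤ t) : S.mst s = S'.mst s := by
  obtain ⟨-, hE, hi, hw⟩ := h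
  have hedges : S.edges s = S'.edges s := by
    ext f
    rw [InsertionData.mem_edges, InsertionData.mem_edges, hE]
    refine or_congr_right (exists_congr fun j => and_congr_right fun hj => ?_)
    rw [(hi j (by omega)).2]
  rw [mst, mst, ← hedges]
  exact mstWeight_congr fun f hf => hw f (S.edges_mono hs hf)

theorem sum_abs_mst_sub_le {S S' : IncrementalSeq V W T} (hW : 1 ≤ W)
    (h : S.EdgeAdj S' ∨ S'.EdgeAdj S) (l : ℕ) :
    ∑ q ∈ Finset.range T, |((S.mst ((q + 1) * 2 ^ l) : ℝ) - S.mst (q * 2 ^ l)) -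
      (S'.mst ((q + 1) * 2 ^ l) - S'.mst (q * 2 ^ l))| ≤ 4 * W := by
  have hτ : Monotone fun q : ℕ => q * 2 ^ l := fun _ _ h => Nat.mul_le_mul_right _ h
  rcases h with h | h
  · obtain ⟨e, i, h, -⟩ := h.insertsAlso
    exact h.sum_abs_le hW hτ T
  · obtain ⟨e, i, h, -⟩ := h.insertsAlso
    refine le_trans (le_of_eq (Finset.sum_congr rfl fun q _ => ?_)) (h.sum_abs_le hW hτ T)
    rw [abs_sub_comm]

theorem mst_zero_eq {S S' : IncrementalSeq V W T} (h : S.EdgeAdj S' ∨ S'.EdgeAdj S) :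
    S.mst 0 = S'.mst 0 := by
  rcases h with h | h
  · obtain ⟨e, i, h, -⟩ := h.insertsAlso
    exact h.mst_eq_of_le (Nat.zero_le _)
  · obtain ⟨e, i, h, -⟩ := h.insertsAlso
    exact (h.mst_eq_of_le (Nat.zero_le _)).symm

end IncrementalSeq

/-- The tree mechanism for the minimum spanning tree weight, with Laplace noise of scale `b` at the
tree nodes and a common shift that is uniform on `[-K, K]`. -/
noncomputable def treeMechanism (V : Type u) [DecidableEq V] (W T : ℕ) {b K : ℝ} (hb : 0 < b)
    (hK : 0 < K) : ContinualMechanism V W T where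
  law S := (treeNoise T b K).map (treeRelease T fun t => S.mst t)
  isProbabilityMeasure S := by
    have := isProbabilityMeasure_laplaceVec (ι := TreeNode T) hb
    have := isProbabilityMeasure_uniformSym hK
    rw [treeNoise]
    exact Measure.isProbabilityMeasure_map (measurable_treeRelease T _).aemeasurable
  causal t S S' h := by
    have hm : Measurable fun (x : Fin T → ℝ) (i : {i : Fin T // i.val < t}) => x i := by fun_prop
    rw [Measure.map_map hm (measurable_treeRelease T _),
      Measure.map_map hm (measurable_treeRelease T _)]
    congr 1
    ext p i
    simp only [Function.comp, treeRelease]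
    rw [h.mst_eq i.2]

theorem treeMechanism_law {V : Type u} [DecidableEq V] {W T : ℕ} {b K : ℝ} (hb : 0 < b)
    (hK : 0 < K) (S : IncrementalSeq V W T) :
    (treeMechanism V W T hb hK).law S =
      (treeNoise T b K).map (treeRelease T fun t => (S.mst t : ℝ)) := rfl

theorem edgeDP_treeMechanism (V : Type u) [DecidableEq V] {W T : ℕ} {b K ε : ℝ} (hW : 1 ≤ W)
    (hb : 0 < b) (hK : 0 < K) (hε : treeDepth T * (4 * W) / b ≤ ε) :
    (treeMechanism V W T hb hK).EdgeDP ε := by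
  intro S S' h O hO
  rw [treeMechanism_law, treeMechanism_law]
  have h0 : (S.mst 0 : ℝ) = S'.mst 0 := by rw [IncrementalSeq.mst_zero_eq h]
  have hle := map_treeRelease_le (f := fun t => (S.mst t : ℝ)) (g := fun t => (S'.mst t : ℝ))
    (M := 4 * W) hb hK h0 (fun l => IncrementalSeq.sum_abs_mst_sub_le hW h l) hO
  exact hle.trans (mul_le_mul_left (ENNReal.ofReal_le_ofReal (Real.exp_le_exp.2 hε)) _)

theorem treeMechanism_accuracy (V : Type u) [DecidableEq V] {W T : ℕ} {b σ : ℝ} (hb : 0 < b)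
    (hσ : 0 < 8 * σ) (hσb : σ = b * Real.sqrt (treeDepth T)) (S : IncrementalSeq V W T) (i : Fin T)
    {δ : ℝ} (hδ : 0 < δ) (hδ1 : δ < 1) :
    ENNReal.ofReal (1 - δ) ≤ (treeMechanism V W T hb hσ).law S
      {x | |x i - (S.mst (i.val + 1) : ℝ)| ≤ 42 * σ * Real.log δ⁻¹} := by
  have hne : (treePath i).Nonempty := by
    rw [← Finset.card_pos, card_treePath]
    exact Nat.succ_pos _
  have hmeas : MeasurableSet
      {x : Fin T → ℝ | |x i - (S.mst (i.val + 1) : ℝ)| ≤ 42 * σ * Real.log δ⁻¹} :=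
    measurableSet_le (by fun_prop) measurable_const
  refine (le_prod_abs_sum_add_le hb hne (σ := σ) (by rw [card_treePath, hσb]) hδ hδ1).trans ?_
  rw [treeMechanism_law, Measure.map_apply (measurable_treeRelease T _) hmeas, treeNoise]
  refine measure_mono fun p hp => ?_
  have hp' : |∑ n ∈ treePath i, p.1 n + p.2| ≤ 42 * σ * Real.log δ⁻¹ := hp
  change |treeRelease T (fun t => (S.mst t : ℝ)) p i - (S.mst (i.val + 1) : ℝ)| ≤ _
  rw [treeRelease, add_sub_cancel_left]
  exact hp'

theorem exists_edgeDP_mechanism (V : Type u) [DecidableEq V] {W T : ℕ} {ε : ℝ} (hW : 1 ≤ W)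
    (hT : 2 ≤ T) (hε : 0 < ε) :
    ∃ A : ContinualMechanism V W T, A.EdgeDP ε ∧
      ∀ (S : IncrementalSeq V W T) (i : Fin T) (δ : ℝ), 0 < δ → δ < 1 →
        ENNReal.ofReal (1 - δ) ≤
          A.law S {x | |x i - (S.mst (i.val + 1) : ℝ)| ≤
            1008 * (W * ε⁻¹ * Real.log T ^ (3 / 2 : ℝ) * Real.log δ⁻¹)} := by
  have hW' : (0 : ℝ) < W := by exact_mod_cast hW
  have hL : (0 : ℝ) < treeDepth T := by exact_mod_cast Nat.succ_pos _
  -- Sensitivity over `ε`: each of the `treeDepth T` levels contributes at most `4W`.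
  set b : ℝ := treeDepth T * (4 * W) / ε with hbdef
  have hb : 0 < b := by positivity
  set σ : ℝ := b * Real.sqrt (treeDepth T) with hσdef
  have hσ : 0 < 8 * σ := by
    have := Real.sqrt_pos.2 hL
    positivity
  refine ⟨treeMechanism V W T hb hσ, edgeDP_treeMechanism V hW hb hσ ?_, fun S i δ hδ hδ1 => ?_⟩
  · rw [hbdef]
    exact le_of_eq (by field_simp)
  · refine (treeMechanism_accuracy V hb hσ hσdef S i hδ hδ1).trans (measure_mono fun x hx => ?_)
    have hx' : |x i - (S.mst (i.val + 1) : ℝ)| ≤ 42 * σ * Real.log δ⁻¹ := hx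
    have hlog : 0 ≤ Real.log δ⁻¹ := Real.log_nonneg ((one_le_inv₀ hδ).2 hδ1.le)
    -- `24 = 4 · 6`, from the sensitivity and `treeDepth_mul_sqrt_le`; then `1008 = 42 · 24`.
    have hσle : σ ≤ 24 * (W * ε⁻¹ * Real.log T ^ (3 / 2 : ℝ)) := by
      calc σ = 4 * W * ε⁻¹ * (treeDepth T * Real.sqrt (treeDepth T)) := by
            rw [hσdef, hbdef, div_eq_mul_inv]; ring
        _ ≤ 4 * W * ε⁻¹ * (6 * Real.log T ^ (3 / 2 : ℝ)) :=
            mul_le_mul_of_nonneg_left (treeDepth_mul_sqrt_le hT) (by positivity)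
        _ = _ := by ring
    have hfin : |x i - (S.mst (i.val + 1) : ℝ)| ≤
        1008 * (W * ε⁻¹ * Real.log T ^ (3 / 2 : ℝ) * Real.log δ⁻¹) := by
      have := mul_le_mul_of_nonneg_right hσle hlog
      linarith
    exact hfin

theorem mainTheorem4 :
    (∃ C : ℝ, 0 < C ∧
      ∀ (V : Type u) [DecidableEq V] (W T : ℕ) (ε : ℝ), 1 ≤ W → 2 ≤ T → 0 < ε →
        ∃ A : ContinualMechanism V W T, A.EdgeDP ε ∧
          ∀ (S : IncrementalSeq V W T) (i : Fin T) (δ : ℝ), 0 < δ → δ < 1 →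
            ENNReal.ofReal (1 - δ) ≤
              A.law S {x | |x i - (S.mst (i.val + 1) : ℝ)| ≤
                C * (W * ε⁻¹ * Real.log T ^ (3 / 2 : ℝ) * Real.log δ⁻¹)}) ∧
    (∀ (V : Type u) [DecidableEq V] [Infinite V] (W : ℕ), 1 ≤ W → ∀ T : ℕ,
      2 * (W : ℝ) - 2 ∈ upperBounds (diffMstDistances V W T) ∧
        (2 ≤ T → IsGreatest (diffMstDistances V W T) (2 * (W : ℝ) - 2))) := by
  refine ⟨⟨1008, by norm_num, fun V _ W T ε hW hT hε => exists_edgeDP_mechanism V hW hT hε⟩,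
    fun V _ _ W hW T => ?_⟩
  have hub := IncrementalSeq.upperBound_diffMstDistances V W T hW
  exact ⟨hub, fun hT =>
    ⟨IncrementalSeq.two_mul_sub_two_mem_diffMstDistances V W T hW hT, hub⟩⟩
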